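/- Let $\Gamma=\{q^\circ : q\in\mathbb{Q}\cap[0,1]\}\cup\{r^- : r\in(0,1]\}$, totally ordered by the underlying numbers with $q^-$ immediately below $q^\circ$, and topologised by the subbasic open sets ${\uparrow}p^\circ$ ($p\in\mathbb{Q}\cap[0,1]$) and ${\downarrow}q^-$ ($q\in\mathbb{Q}\cap(0,1]$). For $y\le x$ in $\Gamma$ define $r^\circ\ominus s^\circ=(r-s)^\circ$, $r^-\ominus s^\circ=(r-s)^-$, let $r^\circ\ominus s^-$ and $r^-\ominus s^-$ be $(r-s)^\circ$ if $r-s$ is rational and $(r-s)^-$ otherwise, and put $x\sim y=\bigvee\{x\ominus q^\circ : y<q^\circ\le x\}$. A $\Gamma$-valued measure on a bounded distributive lattice $D$ is a monotone map $\mu\colon D\to\Gamma$ with $\mu(0)=0^\circ$, $\mu(1)=1^\circ$ and, for all $a,b\in D$, $\mu(a)\sim\mu(a\wedge b)\le\mu(a\vee b)\ominus\mu(b)$ and $\mu(a\vee b)\sim\mu(b)\le\mu(a)\ominus\mu(a\wedge b)$. Let $\mathcal{M}_\Gamma(D)\subseteq\Gamma^D$ be the space of all such measures, with the topology induced by the product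 topology. Let $\sigma$ be a first-order signature and $\mathrm{FO}(\sigma)$ the Boolean algebra of first-order formulas over $\sigma$ in the variables $v_1,v_2,\dots$ modulo logical equivalence (over non-empty structures). Consider the classical propositional logic with atoms $P_{\ge q}\varphi$ and $P_{<q}\varphi$, for $\varphi\in\mathrm{FO}(\sigma)$ and $q\in\mathbb{Q}\cap[0,1]$, with the usual rules for the Boolean connectives and the following inference rules, for all $p,q,r\in\mathbb{Q}\cap[0,1]$ and $\varphi,\psi\in\mathrm{FO}(\sigma)$: - from $P_{\ge q}\varphi$ infer $P_{\ge p}\varphi$, if $p\le q$; - from $P_{\ge q}\varphi$ infer $P_{\ge q}\psi$, if $\varphi\vdash\psi$; - infer $P_{\ge 0}\bot$; infer $P_{<q}\bot$, if $q>0$; infer $P_{\ge q}\top$; - from $P_{\ge q}\varphi$ infer $\neg P_{<q}\varphi$, and conversely; - from $P_{\ge p}\varphi\wedge P_{\ge q}\psi$ infer $P_{\ge p+q-r}(\varphi\vee\psi)\vee P_{\ge r}(\varphi\wedge\psi)$, where $P_{\ge s}\chi$ is read as $\bot$ if $s>1$ and as $\top$ if $s<0$; - from $P_{\ge p+q-r}(\varphi\vee\psi)\wedge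 P_{\ge r}(\varphi\wedge\psi)$ infer $P_{\ge p}\varphi\vee P_{\ge q}\psi$, if $0\le p+q-r\le 1$. For a measure $\mu\in\mathcal{M}_\Gamma(\mathrm{FO}(\sigma))$ let $\mu\models P_{\ge q}\varphi$ iff $\mu(\varphi)\ge q^\circ$, let $\mu\models P_{<q}\varphi$ iff $\mu(\varphi)<q^\circ$, and extend $\models$ to all formulas of the logic in the usual way. Then: 1. $\mathcal{M}_\Gamma(\mathrm{FO}(\sigma))$ is a Boolean space (compact, Hausdorff, with a basis of clopen sets), and it is Stone dual to the Lindenbaum–Tarski algebra of this logic: $[\theta]\mapsto\{\mu : \mu\models\theta\}$ is an isomorphism from that algebra onto the Boolean algebra of clopen subsets of $\mathcal{M}_\Gamma(\mathrm{FO}(\sigma))$, and $\mu\mapsto\{[\theta] : \mu\models\theta\}$ is a homeomorphism from $\mathcal{M}_\Gamma(\mathrm{FO}(\sigma))$ onto the space of prime filters (the $0$-types) of that algebra. 2. For a finite non-empty $\sigma$-structure $A$ let $\langle\varphi,A\rangle=|\{\overline a\in A^n : A\models\varphi(\overline a)\}|/|A|^n$, where the free variables of $\varphi$ are among $v_1,\dots,v_n$.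 The $\Gamma$-valued Stone pairing $A\mapsto(\varphi\mapsto\langle\varphi,A\rangle^\circ)$ is a well-defined injective map from the isomorphism classes of finite non-empty $\sigma$-structures to $\mathcal{M}_\Gamma(\mathrm{FO}(\sigma))$. Under the homeomorphism of part 1 it sends $A$ to the $0$-type $\{[\theta] : A\models\theta\}$, where $A\models P_{\ge q}\varphi$ iff $\langle\varphi,A\rangle\ge q$, and $A\models P_{<q}\varphi$ iff $\langle\varphi,A\rangle<q$. -/

import Mathlib

namespace MeasureLogic

universe u v w

/-! ### The space of values -/

/-- The underlying set of the space `Γ`: the exact values `q°`, for rational `q ∈ [0,1]`, and the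
lower approximations `r⁻`, for real `r ∈ (0,1]`. -/
inductive Gam : Type
  | exact (q : Set.Icc (0 : ℚ) 1) : Gam
  | below (r : Set.Ioc (0 : ℝ) 1) : Gam

namespace Gam

/-- The collapse `γ : Γ → [0,1]`, sending `q°` to `q` and `r⁻` to `r`. -/
noncomputable def gamma : Gam → ℝ
  | exact q => ((q : ℚ) : ℝ)
  | below r => (r : ℝ)

/-- The position of a point of `Γ` in the lexicographic product of `ℝ` and `{false < true}`. -/
noncomputable def key : Gam → ℝ ×ₗ Bool
  | exact q => toLex (((q : ℚ) : ℝ), true)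
  | below r => toLex ((r : ℝ), false)

theorem key_injective : Function.Injective key := by
  rintro (⟨p, hp⟩ | ⟨r, hr⟩) (⟨q, hq⟩ | ⟨s, hs⟩) h <;> simp_all [key]

/-- The total order of `Γ`: points are compared by their value under `γ`, and `q⁻` lies just
below `q°`. -/
noncomputable instance : LinearOrder Gam := LinearOrder.lift' key key_injective

/-- The topology of `Γ`, generated by the sets `↑p°` and `↓q⁻` for rational `p ∈ [0,1]` and
`q ∈ (0,1]`. -/
instance : TopologicalSpace Gam :=
  TopologicalSpace.generateFrom
    ({U | ∃ p : Set.Icc (0 : ℚ) 1, U = Set.Ici (exact p)} ∪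
      {U | ∃ (q : ℚ) (h : (q : ℝ) ∈ Set.Ioc (0 : ℝ) 1), U = Set.Iic (below ⟨(q : ℝ), h⟩)})

theorem gamma_mono {x y : Gam} (h : x ≤ y) : gamma x ≤ gamma y := by
  have h' : key x ≤ key y := h
  rcases x with p | r <;> rcases y with q | s <;>
    exact (Prod.Lex.monotone_fst _ _ h' : _)

theorem gamma_mem (x : Gam) : gamma x ∈ Set.Icc (0 : ℝ) 1 := by
  rcases x with ⟨q, h0, h1⟩ | ⟨r, h0, h1⟩
  · exact ⟨by simpa [gamma] using h0, by simpa [gamma] using (by exact_mod_cast h1 : (q : ℝ) ≤ 1)⟩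
  · exact ⟨h0.le, h1⟩

theorem gamma_sub_mem {x y : Gam} (h : y ≤ x) : gamma x - gamma y ∈ Set.Icc (0 : ℝ) 1 :=
  ⟨sub_nonneg.2 (gamma_mono h), by linarith [(gamma_mem x).2, (gamma_mem y).1]⟩

theorem pos_of_not_rat {x : ℝ} (hx : x ∈ Set.Icc (0 : ℝ) 1)
    (h : ¬ ∃ q : Set.Icc (0 : ℚ) 1, ((q : ℚ) : ℝ) = x) : 0 < x :=
  lt_of_le_of_ne hx.1 fun h0 => h ⟨⟨0, by simp⟩, by simpa using h0⟩

open Classical in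
/-- For `x ∈ [0,1]`: the point `x°` if `x` is rational, and `x⁻` otherwise. -/
noncomputable def upper (x : ℝ) (hx : x ∈ Set.Icc (0 : ℝ) 1) : Gam :=
  if h : ∃ q : Set.Icc (0 : ℚ) 1, ((q : ℚ) : ℝ) = x then exact h.choose
  else below ⟨x, pos_of_not_rat hx h, hx.2⟩

open Classical in
/-- For `x ∈ [0,1]`: the point `x⁻` if `x > 0`, and `0°` if `x = 0`. -/
noncomputable def lower (x : ℝ) (hx : x ∈ Set.Icc (0 : ℝ) 1) : Gam :=
  if h : 0 < x then below ⟨x, h, hx.2⟩ else exact ⟨0, by simp⟩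

/-- The first partial subtraction on `Γ`, defined on the pairs `(x, y)` with `y ≤ x`:
`r° - s° = (r-s)°`, `r⁻ - s° = (r-s)⁻`, and `r° - s⁻`, `r⁻ - s⁻` are both `(r-s)°` or `(r-s)⁻`
according to whether `r - s` is rational. -/
noncomputable def mip : (x y : Gam) → y ≤ x → Gam
  | exact r, exact s, h => upper (gamma (exact r) - gamma (exact s)) (gamma_sub_mem h)
  | below r, exact s, h => lower (gamma (below r) - gamma (exact s)) (gamma_sub_mem h)
  | exact r, below s, h => upper (gamma (exact r) - gamma (below s)) (gamma_sub_mem h)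
  | below r, below s, h => upper (gamma (below r) - gamma (below s)) (gamma_sub_mem h)

/-- The second partial subtraction on `Γ`, defined on the pairs `(x, y)` with `y ≤ x`; it is the
supremum of the differences `mip x q°` over the rationals `q` with `y < q° ≤ x`. Explicitly, it
is `0°` for `x = y`, and for `y < x` it is `(r-s)⁻`, except that `r°` minus `s⁻` is `(r-s)°` or
`(r-s)⁻` according to whether `r - s` is rational. -/
noncomputable def miss : (x y : Gam) → y ≤ x → Gam
  | exact r, exact s, h => lower (gamma (exact r) - gamma (exact s)) (gamma_sub_mem h)
  | below r, exact s, h => lower (gamma (below r) - gamma (exact s)) (gamma_sub_mem h)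
  | exact r, below s, h => upper (gamma (exact r) - gamma (below s)) (gamma_sub_mem h)
  | below r, below s, h => lower (gamma (below r) - gamma (below s)) (gamma_sub_mem h)

end Gam

/-! ### Measures -/

/-- Finitely additive probability measures on a bounded distributive lattice, with values
in `Γ`. -/
structure IsMeasure {D : Type u} [DistribLattice D] [BoundedOrder D] (μ : D → Gam) : Prop where
  mono : Monotone μ
  map_bot : μ ⊥ = Gam.exact ⟨0, by simp⟩
  map_top : μ ⊤ = Gam.exact ⟨1, by simp⟩
  miss_le_mip : ∀ a b : D,
    Gam.miss (μ a) (μ (a ⊓ b)) (mono inf_le_left) ≤ Gam.mip (μ (a ⊔ b)) (μ b) (mono le_sup_right)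
  miss_le_mip' : ∀ a b : D,
    Gam.miss (μ (a ⊔ b)) (μ b) (mono le_sup_right) ≤ Gam.mip (μ a) (μ (a ⊓ b)) (mono inf_le_left)

/-- The space of `Γ`-valued measures on `D`, a subspace of the product `Γ ^ D`. -/
def Mea (D : Type u) [DistribLattice D] [BoundedOrder D] : Type u :=
  {μ : D → Gam // IsMeasure μ}

instance (D : Type u) [DistribLattice D] [BoundedOrder D] : TopologicalSpace (Mea D) :=
  inferInstanceAs (TopologicalSpace {μ : D → Gam // IsMeasure μ})

instance (D : Type u) [DistribLattice D] [BoundedOrder D] : CoeFun (Mea D) (fun _ => D → Gam) :=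
  ⟨fun μ => μ.1⟩

/-! ### The propositional logic of measures -/

/-- Formulas of the logic: the atoms are `P_{≥ q} a` and `P_{< q} a` for `a ∈ D` and rational
`q ∈ [0,1]`. -/
inductive PForm (D : Type u) : Type u
  | ge (q : Set.Icc (0 : ℚ) 1) (a : D) : PForm D
  | lt (q : Set.Icc (0 : ℚ) 1) (a : D) : PForm D
  | top : PForm D
  | bot : PForm D
  | and (φ ψ : PForm D) : PForm D
  | or (φ ψ : PForm D) : PForm D
  | neg (φ : PForm D) : PForm D

/-- `P_{≥ s} a` for an arbitrary rational `s`: the atom if `0 ≤ s ≤ 1`, falsum if `s > 1`, and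
verum if `s < 0`. -/
def PForm.geQ {D : Type u} (s : ℚ) (a : D) : PForm D :=
  if h : s ∈ Set.Icc (0 : ℚ) 1 then PForm.ge ⟨s, h⟩ a else if 1 < s then PForm.bot else PForm.top

/-- Natural deduction: `Derives Γ φ` says that `φ` is derivable from the hypotheses in `Γ`. The
rules up to `dne` are those of classical propositional logic. In the rule `sup_or_inf` the index
`p + q - r` is at least `-1` and at most `2`; outside `[0,1]` it is read as in `PForm.geQ`. -/
inductive Derives {D : Type u} [DistribLattice D] [BoundedOrder D] :
    Set (PForm D) → PForm D → Prop
  | hyp {Γ : Set (PForm D)} {φ : PForm D} : φ ∈ Γ → Derives Γ φ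
  | topI {Γ : Set (PForm D)} : Derives Γ PForm.top
  | botE {Γ : Set (PForm D)} {φ : PForm D} : Derives Γ PForm.bot → Derives Γ φ
  | andI {Γ : Set (PForm D)} {φ ψ : PForm D} :
      Derives Γ φ → Derives Γ ψ → Derives Γ (PForm.and φ ψ)
  | andE₁ {Γ : Set (PForm D)} {φ ψ : PForm D} : Derives Γ (PForm.and φ ψ) → Derives Γ φ
  | andE₂ {Γ : Set (PForm D)} {φ ψ : PForm D} : Derives Γ (PForm.and φ ψ) → Derives Γ ψ
  | orI₁ {Γ : Set (PForm D)} {φ ψ : PForm D} : Derives Γ φ → Derives Γ (PForm.or φ ψ)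
  | orI₂ {Γ : Set (PForm D)} {φ ψ : PForm D} : Derives Γ ψ → Derives Γ (PForm.or φ ψ)
  | orE {Γ : Set (PForm D)} {φ ψ χ : PForm D} : Derives Γ (PForm.or φ ψ) →
      Derives (insert φ Γ) χ → Derives (insert ψ Γ) χ → Derives Γ χ
  | negI {Γ : Set (PForm D)} {φ : PForm D} :
      Derives (insert φ Γ) PForm.bot → Derives Γ (PForm.neg φ)
  | negE {Γ : Set (PForm D)} {φ : PForm D} :
      Derives Γ φ → Derives Γ (PForm.neg φ) → Derives Γ PForm.bot
  | dne {Γ : Set (PForm D)} {φ : PForm D} : Derives Γ (PForm.neg (PForm.neg φ)) → Derives Γ φ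
  | ge_anti {Γ : Set (PForm D)} {p q : Set.Icc (0 : ℚ) 1} {a : D} : p ≤ q →
      Derives Γ (PForm.ge q a) → Derives Γ (PForm.ge p a)
  | ge_mono {Γ : Set (PForm D)} {q : Set.Icc (0 : ℚ) 1} {a b : D} : a ≤ b →
      Derives Γ (PForm.ge q a) → Derives Γ (PForm.ge q b)
  | ge_zero_bot {Γ : Set (PForm D)} : Derives Γ (PForm.ge ⟨0, by simp⟩ ⊥)
  | lt_bot {Γ : Set (PForm D)} {q : Set.Icc (0 : ℚ) 1} : 0 < (q : ℚ) → Derives Γ (PForm.lt q ⊥)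
  | ge_top {Γ : Set (PForm D)} {q : Set.Icc (0 : ℚ) 1} : Derives Γ (PForm.ge q ⊤)
  | neg_lt_of_ge {Γ : Set (PForm D)} {q : Set.Icc (0 : ℚ) 1} {a : D} :
      Derives Γ (PForm.ge q a) → Derives Γ (PForm.neg (PForm.lt q a))
  | ge_of_neg_lt {Γ : Set (PForm D)} {q : Set.Icc (0 : ℚ) 1} {a : D} :
      Derives Γ (PForm.neg (PForm.lt q a)) → Derives Γ (PForm.ge q a)
  | sup_or_inf {Γ : Set (PForm D)} {p q r : Set.Icc (0 : ℚ) 1} {a b : D} :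
      Derives Γ (PForm.and (PForm.ge p a) (PForm.ge q b)) →
      Derives Γ (PForm.or (PForm.geQ ((p : ℚ) + q - r) (a ⊔ b)) (PForm.ge r (a ⊓ b)))
  | of_sup_and_inf {Γ : Set (PForm D)} {p q r : Set.Icc (0 : ℚ) 1} {a b : D}
      (h : (p : ℚ) + q - r ∈ Set.Icc (0 : ℚ) 1) :
      Derives Γ (PForm.and (PForm.ge ⟨(p : ℚ) + q - r, h⟩ (a ⊔ b)) (PForm.ge r (a ⊓ b))) →
      Derives Γ (PForm.or (PForm.ge p a) (PForm.ge q b))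

section Lindenbaum

variable {D : Type u} [DistribLattice D] [BoundedOrder D]

theorem Derives.weaken {Γ : Set (PForm D)} {φ : PForm D} (h : Derives Γ φ) :
    ∀ {Δ : Set (PForm D)}, Γ ⊆ Δ → Derives Δ φ := by
  induction h with
  | hyp h => exact fun s => .hyp (s h)
  | topI => exact fun _ => .topI
  | botE _ ih => exact fun s => .botE (ih s)
  | andI _ _ ih₁ ih₂ => exact fun s => .andI (ih₁ s) (ih₂ s)
  | andE₁ _ ih => exact fun s => .andE₁ (ih s)
  | andE₂ _ ih => exact fun s => .andE₂ (ih s)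
  | orI₁ _ ih => exact fun s => .orI₁ (ih s)
  | orI₂ _ ih => exact fun s => .orI₂ (ih s)
  | orE _ _ _ ih ih₁ ih₂ =>
    exact fun s => .orE (ih s) (ih₁ (Set.insert_subset_insert s)) (ih₂ (Set.insert_subset_insert s))
  | negI _ ih => exact fun s => .negI (ih (Set.insert_subset_insert s))
  | negE _ _ ih₁ ih₂ => exact fun s => .negE (ih₁ s) (ih₂ s)
  | dne _ ih => exact fun s => .dne (ih s)
  | ge_anti h _ ih => exact fun s => .ge_anti h (ih s)
  | ge_mono h _ ih => exact fun s => .ge_mono h (ih s)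
  | ge_zero_bot => exact fun _ => .ge_zero_bot
  | lt_bot h => exact fun _ => .lt_bot h
  | ge_top => exact fun _ => .ge_top
  | neg_lt_of_ge _ ih => exact fun s => .neg_lt_of_ge (ih s)
  | ge_of_neg_lt _ ih => exact fun s => .ge_of_neg_lt (ih s)
  | sup_or_inf _ ih => exact fun s => .sup_or_inf (ih s)
  | of_sup_and_inf h _ ih => exact fun s => .of_sup_and_inf h (ih s)

theorem Derives.cut {Γ : Set (PForm D)} {φ ψ : PForm D} (h : Derives Γ φ)
    (h' : Derives (insert φ Γ) ψ) : Derives Γ ψ :=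
  .orE (.orI₁ (ψ := φ) h) h' h'

/-- `φ ⊢ ψ`. -/
def Entails (φ ψ : PForm D) : Prop := Derives {φ} ψ

theorem Entails.refl (φ : PForm D) : Entails φ φ := .hyp rfl

theorem Entails.trans {φ ψ χ : PForm D} (h : Entails φ ψ) (h' : Entails ψ χ) : Entails φ χ :=
  Derives.cut h (Derives.weaken h' (by simp))

theorem Derives.entails {Γ : Set (PForm D)} {φ ψ : PForm D} (h : Derives Γ φ)
    (h' : Entails φ ψ) : Derives Γ ψ :=
  h.cut (Derives.weaken h' (by simp))

variable (D) in
/-- Provable equivalence. -/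
def provSetoid : Setoid (PForm D) where
  r φ ψ := Entails φ ψ ∧ Entails ψ φ
  iseqv := ⟨fun φ => ⟨.refl φ, .refl φ⟩, fun h => ⟨h.2, h.1⟩,
    fun h h' => ⟨h.1.trans h'.1, h'.2.trans h.2⟩⟩

variable (D) in
/-- The Lindenbaum-Tarski algebra of the logic: formulas modulo provable equivalence. -/
def LTAlg : Type u := Quotient (provSetoid D)

/-- The class of a formula. -/
def LTAlg.mk (φ : PForm D) : LTAlg D := Quotient.mk (provSetoid D) φ

theorem Entails.and_mono {φ φ' ψ ψ' : PForm D} (h : Entails φ φ') (h' : Entails ψ ψ') :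
    Entails (φ.and ψ) (φ'.and ψ') :=
  .andI (Derives.entails (.andE₁ (.hyp rfl)) h) (Derives.entails (.andE₂ (.hyp rfl)) h')

theorem Entails.or_mono {φ φ' ψ ψ' : PForm D} (h : Entails φ φ') (h' : Entails ψ ψ') :
    Entails (φ.or ψ) (φ'.or ψ') :=
  .orE (.hyp rfl) (.orI₁ (Derives.weaken h (by simp))) (.orI₂ (Derives.weaken h' (by simp)))

theorem Entails.neg_mono {φ ψ : PForm D} (h : Entails φ ψ) : Entails ψ.neg φ.neg :=
  .negI (.negE (Derives.weaken h (by simp)) (.hyp (by simp)))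

/-- The Boolean algebra structure: `φ ≤ ψ` iff `φ ⊢ ψ`, and the operations are given by the
connectives. -/
instance : BooleanAlgebra (LTAlg D) where
  le := Quotient.lift₂ Entails fun _ _ _ _ h h' =>
    propext ⟨fun k => h.2.trans (k.trans h'.1), fun k => h.1.trans (k.trans h'.2)⟩
  le_refl := by rintro ⟨φ⟩; exact Entails.refl φ
  le_trans := by rintro ⟨φ⟩ ⟨ψ⟩ ⟨χ⟩ h h'; exact Entails.trans h h'
  le_antisymm := by rintro ⟨φ⟩ ⟨ψ⟩ h h'; exact Quotient.sound ⟨h, h'⟩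
  sup := Quotient.map₂ PForm.or fun _ _ h _ _ h' =>
    ⟨Entails.or_mono h.1 h'.1, Entails.or_mono h.2 h'.2⟩
  inf := Quotient.map₂ PForm.and fun _ _ h _ _ h' =>
    ⟨Entails.and_mono h.1 h'.1, Entails.and_mono h.2 h'.2⟩
  compl := Quotient.map PForm.neg fun _ _ h => ⟨Entails.neg_mono h.2, Entails.neg_mono h.1⟩
  top := LTAlg.mk PForm.top
  bot := LTAlg.mk PForm.bot
  le_sup_left := by rintro ⟨φ⟩ ⟨ψ⟩; exact Derives.orI₁ (.hyp rfl)
  le_sup_right := by rintro ⟨φ⟩ ⟨ψ⟩; exact Derives.orI₂ (.hyp rfl)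
  sup_le := by
    rintro ⟨φ⟩ ⟨ψ⟩ ⟨χ⟩ h h'
    exact Derives.orE (.hyp rfl) (Derives.weaken h (by simp)) (Derives.weaken h' (by simp))
  inf_le_left := by rintro ⟨φ⟩ ⟨ψ⟩; exact Derives.andE₁ (.hyp rfl)
  inf_le_right := by rintro ⟨φ⟩ ⟨ψ⟩; exact Derives.andE₂ (.hyp rfl)
  le_inf := by rintro ⟨φ⟩ ⟨ψ⟩ ⟨χ⟩ h h'; exact Derives.andI h h'
  le_sup_inf := by
    rintro ⟨φ⟩ ⟨ψ⟩ ⟨χ⟩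
    refine Derives.orE (φ := φ) (ψ := ψ) (.andE₁ (.hyp rfl)) (.orI₁ (.hyp (by simp))) ?_
    refine Derives.orE (φ := φ) (ψ := χ) (.andE₂ (ψ := φ.or χ) (.hyp (Or.inr rfl)))
      (.orI₁ (.hyp (by simp))) ?_
    exact .orI₂ (.andI (.hyp (by simp)) (.hyp (by simp)))
  le_top := by rintro ⟨φ⟩; exact Derives.topI
  bot_le := by rintro ⟨φ⟩; exact Derives.botE (.hyp rfl)
  inf_compl_le_bot := by
    rintro ⟨φ⟩; exact Derives.negE (φ := φ) (.andE₁ (.hyp rfl)) (.andE₂ (.hyp rfl))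
  top_le_sup_compl := by
    rintro ⟨φ⟩
    refine Derives.dne (.negI (.negE (φ := φ.or φ.neg) ?_ (.hyp (by simp))))
    refine .orI₂ (.negI (.negE (φ := φ.or φ.neg) (.orI₁ (.hyp (by simp))) (.hyp (by simp))))

/-- Satisfaction of a formula of the logic in a measure: `μ ⊨ P_{≥ q} a` iff `μ(a) ≥ q°`, and
`μ ⊨ P_{< q} a` iff `μ(a) < q°`. -/
def Mea.Sat (μ : Mea D) : PForm D → Prop
  | .ge q a => Gam.exact q ≤ μ a
  | .lt q a => μ a < Gam.exact q
  | .top => True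
  | .bot => False
  | .and φ ψ => Mea.Sat μ φ ∧ Mea.Sat μ ψ
  | .or φ ψ => Mea.Sat μ φ ∨ Mea.Sat μ ψ
  | .neg φ => ¬ Mea.Sat μ φ

end Lindenbaum

/-! ### Stone duality -/

/-- The dual space of a Boolean algebra: its prime filters. -/
def StoneSpace (B : Type u) [BooleanAlgebra B] : Type u := {F : Order.PFilter B // F.IsPrime}

/-- The topology generated by the sets of prime filters containing a given element, and their
complements. -/
instance (B : Type u) [BooleanAlgebra B] : TopologicalSpace (StoneSpace B) :=
  TopologicalSpace.generateFrom
    ({U | ∃ a : B, U = {F | a ∈ F.1}} ∪ {U | ∃ a : B, U = {F | a ∉ F.1}})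

/-! ### First-order logic and finite structures -/

section FirstOrderLogic

open FirstOrder FirstOrder.Language

variable (L : FirstOrder.Language.{u, v})

/-- First-order formulas in the variables indexed by `ℕ`, modulo logical equivalence. -/
def FO : Type (max u v) := Quotient ((∅ : L.Theory).iffSetoid : Setoid (L.Formula ℕ))

variable {L}

/-- The class of a first-order formula. -/
def FO.mk (φ : L.Formula ℕ) : FO L :=
  Quotient.mk ((∅ : L.Theory).iffSetoid : Setoid (L.Formula ℕ)) φ

theorem imp_iff {φ ψ : L.Formula ℕ} : Theory.Imp (∅ : L.Theory) φ ψ ↔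
    ∀ (M : Theory.ModelType.{u, v, max u v} (∅ : L.Theory)) (x : ℕ → M),
      φ.Realize x → ψ.Realize x :=
  Theory.models_formula_iff

theorem iff_of {φ ψ : L.Formula ℕ} (h : Theory.Imp (∅ : L.Theory) φ ψ)
    (h' : Theory.Imp (∅ : L.Theory) ψ φ) :
    ((∅ : L.Theory).iffSetoid : Setoid (L.Formula ℕ)) φ ψ :=
  Theory.imp_antisymm h h'

/-- The Lindenbaum-Tarski algebra of first-order logic: the order is logical consequence, and the
operations are given by the connectives. -/
instance : BooleanAlgebra (FO L) where
  le := Quotient.lift₂ (fun φ ψ : L.Formula ℕ => Theory.Imp (∅ : L.Theory) φ ψ)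
    fun _ _ _ _ (h : Theory.Iff _ _ _) (h' : Theory.Iff _ _ _) =>
    propext ⟨fun k => h.mpr.trans (k.trans h'.mp), fun k => h.mp.trans (k.trans h'.mpr)⟩
  le_refl := by rintro ⟨φ⟩; exact Theory.Imp.refl φ
  le_trans := by rintro ⟨φ⟩ ⟨ψ⟩ ⟨χ⟩ h h'; exact Theory.Imp.trans h h'
  le_antisymm := by rintro ⟨φ⟩ ⟨ψ⟩ h h'; exact Quotient.sound (iff_of h h')
  sup := Quotient.map₂ (fun φ ψ : L.Formula ℕ => φ ⊔ ψ)
    fun _ _ (h : Theory.Iff _ _ _) _ _ (h' : Theory.Iff _ _ _) => iff_of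
      (Theory.sup_imp (h.mp.trans (Theory.imp_sup_left _ _))
        (h'.mp.trans (Theory.imp_sup_right _ _)))
      (Theory.sup_imp (h.mpr.trans (Theory.imp_sup_left _ _))
        (h'.mpr.trans (Theory.imp_sup_right _ _)))
  inf := Quotient.map₂ (fun φ ψ : L.Formula ℕ => φ ⊓ ψ)
    fun _ _ (h : Theory.Iff _ _ _) _ _ (h' : Theory.Iff _ _ _) => iff_of
      (Theory.imp_inf ((Theory.inf_imp_left _ _).trans h.mp)
        ((Theory.inf_imp_right _ _).trans h'.mp))
      (Theory.imp_inf ((Theory.inf_imp_left _ _).trans h.mpr)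
        ((Theory.inf_imp_right _ _).trans h'.mpr))
  compl := Quotient.map (fun φ : L.Formula ℕ => φ.not)
    fun _ _ (h : Theory.Iff _ _ _) => Theory.Iff.not h
  top := FO.mk ⊤
  bot := FO.mk ⊥
  le_sup_left := by rintro ⟨φ⟩ ⟨ψ⟩; exact Theory.imp_sup_left φ ψ
  le_sup_right := by rintro ⟨φ⟩ ⟨ψ⟩; exact Theory.imp_sup_right φ ψ
  sup_le := by rintro ⟨φ⟩ ⟨ψ⟩ ⟨χ⟩ h h'; exact Theory.sup_imp h h'
  inf_le_left := by rintro ⟨φ⟩ ⟨ψ⟩; exact Theory.inf_imp_left φ ψ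
  inf_le_right := by rintro ⟨φ⟩ ⟨ψ⟩; exact Theory.inf_imp_right φ ψ
  le_inf := by rintro ⟨φ⟩ ⟨ψ⟩ ⟨χ⟩ h h'; exact Theory.imp_inf h h'
  le_sup_inf := by
    rintro ⟨φ⟩ ⟨ψ⟩ ⟨χ⟩
    refine imp_iff.2 fun M x h => ?_
    simp only [Formula.realize_sup, Formula.realize_inf] at h ⊢
    tauto
  le_top := by rintro ⟨φ⟩; exact Theory.imp_top φ
  bot_le := by rintro ⟨φ⟩; exact Theory.bot_imp φ
  inf_compl_le_bot := by
    rintro ⟨φ⟩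
    refine imp_iff.2 fun M x h => ?_
    simp only [Formula.realize_inf, Formula.realize_not] at h
    exact absurd h.1 h.2
  top_le_sup_compl := by
    rintro ⟨φ⟩
    refine imp_iff.2 fun M x _ => ?_
    simp only [Formula.realize_sup, Formula.realize_not]
    exact em _

variable (L) in
/-- Finite (non-empty) structures. -/
structure FinStr : Type (max u v (w + 1)) where
  carrier : Type w
  [str : L.Structure carrier]
  [fin : Finite carrier]
  [ne : Nonempty carrier]

attribute [instance] FinStr.str FinStr.fin FinStr.ne

variable (L) in
/-- Isomorphism of finite structures. -/
def isoSetoid : Setoid (FinStr.{u, v, w} L) where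
  r A B := Nonempty (A.carrier ≃[L] B.carrier)
  iseqv := ⟨fun A => ⟨FirstOrder.Language.Equiv.refl L A.carrier⟩, fun ⟨e⟩ => ⟨e.symm⟩,
    fun ⟨e⟩ ⟨f⟩ => ⟨f.comp e⟩⟩

variable (L) in
/-- The isomorphism classes of finite structures. -/
def FinIso : Type (max u v (w + 1)) := Quotient (isoSetoid.{u, v, w} L)

/-- The isomorphism class of a finite structure. -/
def FinStr.cls (A : FinStr.{u, v, w} L) : FinIso.{u, v, w} L := Quotient.mk (isoSetoid L) A

/-- For a formula `φ` in the variables `v_0, …, v_{n-1}`, the probability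
`|{a ∈ A ^ n | A ⊨ φ(a)}| / |A| ^ n` that a random assignment in `A` satisfies `φ`. -/
noncomputable def FinStr.prob (A : FinStr.{u, v, w} L) (n : ℕ) (φ : L.Formula (Fin n)) : ℚ :=
  (Nat.card {a : Fin n → A.carrier // φ.Realize a} : ℚ) / (Nat.card A.carrier : ℚ) ^ n

/-- A number `n` such that the free variables of `φ` are among `v_0, …, v_{n-1}`. -/
def varBound (φ : L.Formula ℕ) : ℕ := φ.freeVarFinset.sup id + 1

/-- The formula `φ`, seen as a formula in the variables `v_0, …, v_{n-1}` only. -/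
def restrictVars (φ : L.Formula ℕ) : L.Formula (Fin (varBound φ)) :=
  BoundedFormula.restrictFreeVar φ fun x =>
    ⟨x.1, Nat.lt_succ_of_le (Finset.le_sup (f := id) x.2)⟩

theorem realize_restrictVars {M : Type w} [L.Structure M] (φ : L.Formula ℕ) (x : ℕ → M) :
    (restrictVars φ).Realize (fun i => x i) ↔ φ.Realize x :=
  BoundedFormula.realize_restrictFreeVar x (fun _ => rfl)

theorem FinStr.prob_eq_of_add (A : FinStr.{u, v, w} L) (n k : ℕ) (φ : L.Formula (Fin n))
    (ψ : L.Formula (Fin (n + k)))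
    (h : ∀ x : ℕ → A.carrier, φ.Realize (fun i => x i) ↔ ψ.Realize (fun i => x i)) :
    A.prob n φ = A.prob (n + k) ψ := by
  have h' : ∀ (a : Fin n → A.carrier) (b : Fin k → A.carrier),
      ψ.Realize (Fin.append a b) ↔ φ.Realize a := by
    intro a b
    have := h fun i => if hi : i < n + k then Fin.append a b ⟨i, hi⟩ else Classical.arbitrary _
    have e₁ : (fun i : Fin n => if hi : (i : ℕ) < n + k then Fin.append a b ⟨i, hi⟩
        else Classical.arbitrary A.carrier) = a := by
      funext i
      rw [dif_pos (by omega)]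
      exact Fin.append_left a b i
    have e₂ : (fun i : Fin (n + k) => if hi : (i : ℕ) < n + k then Fin.append a b ⟨i, hi⟩
        else Classical.arbitrary A.carrier) = Fin.append a b := by
      funext i
      rw [dif_pos i.2]
    rw [e₁, e₂] at this
    exact this.symm
  have hc : Nat.card {a : Fin (n + k) → A.carrier // ψ.Realize a} =
      Nat.card {a : Fin n → A.carrier // φ.Realize a} * Nat.card A.carrier ^ k := by
    have e : {p : (Fin n → A.carrier) × (Fin k → A.carrier) // φ.Realize p.1} ≃
        {a : Fin (n + k) → A.carrier // ψ.Realize a} :=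
      (Fin.appendEquiv n k).subtypeEquiv fun p => (h' p.1 p.2).symm
    have e' : {p : (Fin n → A.carrier) × (Fin k → A.carrier) // φ.Realize p.1} ≃
        {a : Fin n → A.carrier // φ.Realize a} × (Fin k → A.carrier) :=
      ⟨fun p => (⟨p.1.1, p.2⟩, p.1.2), fun q => ⟨(q.1.1, q.2), q.1.2⟩, fun _ => rfl, fun _ => rfl⟩
    rw [← Nat.card_congr e, Nat.card_congr e', Nat.card_prod, Nat.card_fun, Nat.card_fin]
  have h0 : (Nat.card A.carrier : ℚ) ≠ 0 := by exact_mod_cast Nat.card_pos.ne'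
  rw [FinStr.prob, FinStr.prob, hc]
  push_cast
  rw [pow_add]
  field_simp

theorem FinStr.prob_eq (A : FinStr.{u, v, w} L) (n m : ℕ) (φ : L.Formula (Fin n))
    (ψ : L.Formula (Fin m))
    (h : ∀ x : ℕ → A.carrier, φ.Realize (fun i => x i) ↔ ψ.Realize (fun i => x i)) :
    A.prob n φ = A.prob m ψ := by
  rcases le_total n m with hnm | hnm
  · obtain ⟨k, rfl⟩ := Nat.exists_eq_add_of_le hnm
    exact A.prob_eq_of_add n k φ ψ h
  · obtain ⟨k, rfl⟩ := Nat.exists_eq_add_of_le hnm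
    exact (A.prob_eq_of_add m k ψ φ fun x => (h x).symm).symm

theorem realize_congr {φ ψ : L.Formula ℕ} {M : Type w} [L.Structure M] [Nonempty M]
    (h : Theory.Iff (∅ : L.Theory) φ ψ) (x : ℕ → M) : φ.Realize x ↔ ψ.Realize x :=
  Theory.Iff.realize_iff h

/-- The classical Stone pairing `⟨φ, A⟩`: the probability that a random assignment in `A` of the
variables of `φ` satisfies `φ`. -/
noncomputable def FinStr.pairing (A : FinStr.{u, v, w} L) : FO L → ℚ :=
  Quotient.lift (fun φ : L.Formula ℕ => A.prob (varBound φ) (restrictVars φ))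
    fun φ ψ (h : Theory.Iff _ φ ψ) => A.prob_eq _ _ _ _ fun x => by
      rw [realize_restrictVars, realize_restrictVars, realize_congr h x]

/-- The Stone pairing does not depend on the set of variables in which a formula is read. -/
theorem FinStr.pairing_mk (A : FinStr.{u, v, w} L) (n : ℕ) (φ : L.Formula (Fin n)) :
    A.pairing (FO.mk (φ.relabel Fin.val)) = A.prob n φ :=
  A.prob_eq _ _ _ _ fun x => by
    rw [realize_restrictVars, Formula.realize_relabel]
    rfl

theorem FinStr.pairing_mem (A : FinStr.{u, v, w} L) (d : FO L) :
    A.pairing d ∈ Set.Icc (0 : ℚ) 1 := by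
  rcases d with ⟨φ⟩
  change A.prob (varBound φ) (restrictVars φ) ∈ _
  refine ⟨by unfold FinStr.prob; positivity, div_le_one_of_le₀ ?_ (by positivity)⟩
  have := Finite.card_subtype_le fun a : Fin (varBound φ) → A.carrier => (restrictVars φ).Realize a
  rw [Nat.card_fun, Nat.card_fin] at this
  exact_mod_cast this

/-- The value `⟨φ, A⟩°` of the `Γ`-valued Stone pairing. -/
noncomputable def FinStr.gammaPairing (A : FinStr.{u, v, w} L) (d : FO L) : Gam :=
  Gam.exact ⟨A.pairing d, A.pairing_mem d⟩

/-- Satisfaction in a finite structure of the sentences of first-order logic with one layer of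
probabilistic quantifiers: `A ⊨ P_{≥ q} φ` iff a random assignment in `A` satisfies `φ` with
probability at least `q`, and `A ⊨ P_{< q} φ` iff it does so with probability less than `q`. -/
def FinStr.Sat (A : FinStr.{u, v, w} L) : PForm (FO L) → Prop
  | .ge q d => (q : ℚ) ≤ A.pairing d
  | .lt q d => A.pairing d < (q : ℚ)
  | .top => True
  | .bot => False
  | .and φ ψ => FinStr.Sat A φ ∧ FinStr.Sat A ψ
  | .or φ ψ => FinStr.Sat A φ ∨ FinStr.Sat A ψ
  | .neg φ => ¬ FinStr.Sat A φ

end FirstOrderLogic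

end MeasureLogic

open MeasureLogic

universe u v w

/-! A point `x` of `Γ` is the same thing as the cut of rationals `q` with `q° ≤ x`, extended by all
negative rationals: cuts with a greatest element are the points `q°`, the others are the points `r⁻`
(`Gam.exists_ratLE_iff`). In this language the first subtraction is a residual, and the second is
generated by the differences `p - r` with `p` in the cut of `x` and `r` outside that of `y`. So the
two measure inequalities become elementary implications between statements `q ≤ μ(a)`
(`Gam.miss_le_mip_iff`), and these have exactly the shape of the last two inference rules.

Hence a measure is a truth assignment to the atoms that respects the rules, that is, a prime filter
of the Lindenbaum-Tarski algebra: `Derives.sound` turns measures into prime filters and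
`StoneSpace.exists_mea` goes back. The bijection is a homeomorphism because the subbasic open sets
of measures are those defined by atoms. Compactness and separation then come from the Stone space,
completeness from the prime ideal theorem, and the description of the clopen sets from compactness.

The classical Stone pairing is modular, so its exact values form a measure. It determines `A`:
enumerate `A` by a tuple. If no tuple of `B` satisfied the same formulas, a finite conjunction would
have positive probability in `A` and probability zero in `B`. A matching tuple gives an embedding of
`A` in `B`; by symmetry and finiteness it is an isomorphism. -/

namespace MeasureLogic

/-! ### Points of `Γ` as cuts of the rationals. -/

namespace Gam

/-- `q ≤ x`, for an arbitrary rational `q` and a point `x` of `Γ`. -/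
def RatLE (q : ℚ) : Gam → Prop
  | exact s => (q : ℝ) ≤ ((s : ℚ) : ℝ)
  | below r => (q : ℝ) < r

theorem ratLE_exact {q : ℚ} {s : Set.Icc (0 : ℚ) 1} :
    RatLE q (exact s) ↔ (q : ℝ) ≤ ((s : ℚ) : ℝ) := Iff.rfl

theorem ratLE_below {q : ℚ} {r : Set.Ioc (0 : ℝ) 1} : RatLE q (below r) ↔ (q : ℝ) < r := Iff.rfl

theorem le_iff_key {x y : Gam} : x ≤ y ↔ key x ≤ key y := Iff.rfl

theorem exact_le_iff {q : Set.Icc (0 : ℚ) 1} {x : Gam} : exact q ≤ x ↔ RatLE q x := by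
  rw [le_iff_key]
  rcases x with s | r
  · simp only [key, ratLE_exact, Prod.Lex.toLex_le_toLex]
    simp [le_iff_lt_or_eq]
  · simp [key, RatLE, Prod.Lex.toLex_le_toLex]

theorem RatLE.anti {p q : ℚ} {x : Gam} (h : p ≤ q) (hq : RatLE q x) : RatLE p x := by
  have h' : (p : ℝ) ≤ q := by exact_mod_cast h
  rcases x with s | r
  · exact h'.trans hq
  · exact h'.trans_lt hq

theorem ratLE_of_nonpos {q : ℚ} (h : q ≤ 0) (x : Gam) : RatLE q x := by
  have h' : (q : ℝ) ≤ 0 := by exact_mod_cast h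
  rcases x with s | r
  · exact h'.trans (by exact_mod_cast s.2.1)
  · exact h'.trans_lt r.2.1

theorem RatLE.le_one {q : ℚ} {x : Gam} (h : RatLE q x) : q ≤ 1 := by
  rcases x with s | r
  · have h' : q ≤ s := by exact_mod_cast (show (q : ℝ) ≤ _ from h)
    exact h'.trans s.2.2
  · exact_mod_cast (show (q : ℝ) < _ from h).le.trans r.2.2

theorem pos_of_not_ratLE {q : ℚ} {x : Gam} (h : ¬ RatLE q x) : 0 < q :=
  not_le.1 fun h' => h (ratLE_of_nonpos h' x)

theorem RatLE.lt {p q : ℚ} {x : Gam} (hp : RatLE p x) (hq : ¬ RatLE q x) : p < q :=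
  not_le.1 fun h => hq (hp.anti h)

theorem RatLE.mono {q : ℚ} {x y : Gam} (h : x ≤ y) (hq : RatLE q x) : RatLE q y := by
  rcases le_total q 0 with h0 | h0
  · exact ratLE_of_nonpos h0 y
  · exact exact_le_iff.1 ((exact_le_iff (q := ⟨q, h0, hq.le_one⟩).2 hq).trans h)

theorem le_iff_ratLE {x y : Gam} : x ≤ y ↔ ∀ q, RatLE q x → RatLE q y := by
  refine ⟨fun h q hq => hq.mono h, fun h => ?_⟩
  rcases x with s | r
  · exact exact_le_iff.2 (h s (le_refl ((s : ℚ) : ℝ)))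
  rw [le_iff_key]
  rcases y with s | t
  · have : (r : ℝ) ≤ ((s : ℚ) : ℝ) := by
      by_contra hc
      obtain ⟨q, hq, hq'⟩ := exists_rat_btwn (not_le.1 hc)
      exact hq.not_ge (h q hq')
    simp only [key, Prod.Lex.toLex_le_toLex]
    simpa [le_iff_lt_or_eq] using this
  · have : (r : ℝ) ≤ t := by
      by_contra hc
      obtain ⟨q, hq, hq'⟩ := exists_rat_btwn (not_le.1 hc)
      exact lt_asymm hq (h q hq')
    simp only [key, Prod.Lex.toLex_le_toLex]
    simpa using this.lt_or_eq

theorem ext_ratLE {x y : Gam} (h : ∀ q, RatLE q x ↔ RatLE q y) : x = y :=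
  le_antisymm (le_iff_ratLE.2 fun q => (h q).1) (le_iff_ratLE.2 fun q => (h q).2)

/-- The points of `Γ` are the cuts of the rationals in `[0,1]`. -/
theorem exists_ratLE_iff (I : ℚ → Prop) (anti : ∀ p q, p ≤ q → I q → I p)
    (h0 : ∀ q ≤ 0, I q) (h1 : ∀ q, I q → q ≤ 1) : ∃ x : Gam, ∀ q, RatLE q x ↔ I q := by
  -- A greatest element `m` gives `m°`. Otherwise the supremum `r` is not attained, and the cut is
  -- that of `r⁻`.
  by_cases hm : ∃ m, I m ∧ ∀ q, I q → q ≤ m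
  · obtain ⟨m, hm, hm'⟩ := hm
    refine ⟨exact ⟨m, hm' 0 (h0 0 le_rfl), h1 m hm⟩, fun q => ?_⟩
    change (q : ℝ) ≤ (m : ℝ) ↔ _
    rw [Rat.cast_le]
    exact ⟨fun h => anti q m h hm, hm' q⟩
  · push Not at hm
    set S : Set ℝ := {x | ∃ q : ℚ, I q ∧ (q : ℝ) = x}
    have hb : BddAbove S := ⟨1, by rintro _ ⟨q, hq, rfl⟩; exact_mod_cast h1 q hq⟩
    have hlt : ∀ q, I q → (q : ℝ) < sSup S := fun q hq => by
      obtain ⟨p, hp, hqp⟩ := hm q hq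
      exact (Rat.cast_lt.2 hqp).trans_le (le_csSup hb ⟨p, hp, rfl⟩)
    have hne : S.Nonempty := ⟨_, 0, h0 0 le_rfl, rfl⟩
    refine ⟨below ⟨sSup S, by simpa using hlt 0 (h0 0 le_rfl), csSup_le hne ?_⟩, fun q => ?_⟩
    · rintro _ ⟨q, hq, rfl⟩; exact_mod_cast h1 q hq
    · refine ⟨fun h => ?_, hlt q⟩
      obtain ⟨_, ⟨p, hp, rfl⟩, hqp⟩ := exists_lt_of_lt_csSup hne (show (q : ℝ) < sSup S from h)
      exact anti q p (Rat.cast_lt.1 hqp).le hp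

/-- The closed cut at `x`. At an irrational `x` it contains the same rationals as the open one,
which is why `upper` may take the value `x⁻` there. -/
theorem ratLE_upper {x : ℝ} (hx : x ∈ Set.Icc (0 : ℝ) 1) {t : ℚ} :
    RatLE t (upper x hx) ↔ (t : ℝ) ≤ x := by
  unfold upper
  split_ifs with h
  · change (t : ℝ) ≤ ((h.choose : ℚ) : ℝ) ↔ _
    rw [h.choose_spec]
  · change (t : ℝ) < x ↔ _
    refine ⟨le_of_lt, fun h' => lt_of_le_of_ne h' fun he => h ?_⟩
    subst he
    exact ⟨⟨t, by exact_mod_cast hx.1, by exact_mod_cast hx.2⟩, rfl⟩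

/-- The open cut at `x`; the second disjunct matters only for `x = 0`, where the value is `0°`. -/
theorem ratLE_lower {x : ℝ} (hx : x ∈ Set.Icc (0 : ℝ) 1) {t : ℚ} :
    RatLE t (lower x hx) ↔ (t : ℝ) < x ∨ t ≤ 0 := by
  unfold lower
  split_ifs with h
  · change (t : ℝ) < x ↔ _
    refine ⟨Or.inl, fun h' => h'.elim id fun h' => lt_of_le_of_lt ?_ h⟩
    exact_mod_cast h'
  · change (t : ℝ) ≤ ((0 : ℚ) : ℝ) ↔ _
    rw [Rat.cast_le]
    refine ⟨Or.inr, fun h' => h'.elim (fun h' => ?_) id⟩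
    exact_mod_cast (h'.le.trans (not_lt.1 h))

/-- Residuation: the difference is the largest cut whose sum with `w` stays below `z`. If the cut of
`w` is open, density of the rationals recovers the bound at its missing endpoint. -/
theorem ratLE_mip {z w : Gam} (h : w ≤ z) {t : ℚ} :
    RatLE t (mip z w h) ↔ ∀ q, RatLE q w → RatLE (t + q) z := by
  have hg := gamma_mono h
  rcases z with r | r <;> rcases w with s | s
  · simp only [mip, ratLE_upper, gamma, ratLE_exact, Rat.cast_add]
    exact ⟨fun h q hq => by linarith, fun h => by linarith [h s le_rfl]⟩
  · simp only [mip, ratLE_upper, gamma, ratLE_exact, ratLE_below, Rat.cast_add]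
    refine ⟨fun h q hq => by linarith, fun h => ?_⟩
    by_contra hc
    obtain ⟨q, hq, hq'⟩ := exists_rat_btwn (show ((r : ℚ) : ℝ) - t < s by linarith)
    linarith [h q hq']
  · simp only [mip, ratLE_lower, gamma, ratLE_exact, ratLE_below, Rat.cast_add] at hg ⊢
    -- Strict, since `r⁻ < r°`; this absorbs the disjunct `t ≤ 0` coming from `lower`.
    have hlt : ((s : ℚ) : ℝ) < r := exact_le_iff.1 h
    refine ⟨fun h q hq => ?_, fun h => Or.inl (by linarith [h s le_rfl])⟩
    rcases h with h | h
    · linarith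
    · have : (t : ℝ) ≤ 0 := by exact_mod_cast h
      linarith
  · simp only [mip, ratLE_upper, gamma, ratLE_below, Rat.cast_add]
    refine ⟨fun h q hq => by linarith, fun h => ?_⟩
    by_contra hc
    obtain ⟨q, hq, hq'⟩ := exists_rat_btwn (show (r : ℝ) - t < s by linarith)
    linarith [h q hq']

/-- The dual description. The disjunct `t ≤ 0` adds only `t = 0` in the case `x = y`, where every
difference `p - r` is negative. -/
theorem ratLE_miss {x y : Gam} (h : y ≤ x) {t : ℚ} :
    RatLE t (miss x y h) ↔ t ≤ 0 ∨ ∃ p r, RatLE p x ∧ ¬ RatLE r y ∧ t = p - r := by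
  have hg := gamma_mono h
  rcases x with r | r <;> rcases y with s | s
  · simp only [miss, ratLE_lower, gamma, ratLE_exact, not_le]
    rw [or_comm]
    refine or_congr_right ⟨fun h => ⟨r, r - t, le_rfl, ?_, by ring⟩, ?_⟩
    · push_cast; linarith
    · rintro ⟨p, q, hp, hq, rfl⟩; push_cast; linarith
  · simp only [miss, ratLE_upper, gamma, ratLE_exact, ratLE_below, not_lt] at hg ⊢
    constructor
    · refine fun h => Or.inr ⟨r, r - t, le_rfl, ?_, by ring⟩
      push_cast; linarith
    · rintro (h | ⟨p, q, hp, hq, rfl⟩)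
      · have : (t : ℝ) ≤ 0 := by exact_mod_cast h
        linarith
      · push_cast; linarith
  · simp only [miss, ratLE_lower, gamma, ratLE_exact, ratLE_below, not_le]
    rw [or_comm]
    refine or_congr_right ⟨fun h => ?_, ?_⟩
    · obtain ⟨p, hp, hp'⟩ := exists_rat_btwn (show ((s : ℚ) : ℝ) + t < r by linarith)
      refine ⟨p, p - t, hp', ?_, by ring⟩
      push_cast; linarith
    · rintro ⟨p, q, hp, hq, rfl⟩; push_cast; linarith
  · simp only [miss, ratLE_lower, gamma, ratLE_below, not_lt]
    rw [or_comm]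
    refine or_congr_right ⟨fun h => ?_, ?_⟩
    · obtain ⟨p, hp, hp'⟩ := exists_rat_btwn (show (s : ℝ) + t < r by linarith)
      refine ⟨p, p - t, hp', ?_, by ring⟩
      push_cast; linarith
    · rintro ⟨p, q, hp, hq, rfl⟩; push_cast; linarith

/-- The link between the subtractions and the logic: the two descriptions above combine into a
statement about cuts only. The values `t ≤ 0` impose no condition because `w ≤ z`. -/
theorem miss_le_mip_iff {x y z w : Gam} (hyx : y ≤ x) (hwz : w ≤ z) :
    miss x y hyx ≤ mip z w hwz ↔
      ∀ p r q, RatLE p x → ¬ RatLE r y → RatLE q w → RatLE (p - r + q) z := by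
  rw [le_iff_ratLE]
  simp only [ratLE_miss, ratLE_mip]
  constructor
  · exact fun h p r q hp hr hq => h (p - r) (Or.inr ⟨p, r, hp, hr, rfl⟩) q hq
  · rintro h t (ht | ⟨p, r, hp, hr, rfl⟩) q hq
    · exact (hq.mono hwz).anti (by linarith)
    · exact h p r q hp hr hq

theorem le_below_iff {q : ℚ} (h : (q : ℝ) ∈ Set.Ioc (0 : ℝ) 1) {x : Gam} :
    x ≤ below ⟨q, h⟩ ↔ ¬ RatLE q x :=
  le_iff_ratLE.trans ⟨fun h h' => lt_irrefl (q : ℝ) (h q h'),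
    fun h _ hp => Rat.cast_lt.2 (hp.lt h)⟩

/-- As `q⁻` is the immediate predecessor of `q°`, the complement of `↑q°` is the subbasic set `↓q⁻`;
for `q = 0` it is empty. -/
theorem isClopen_setOf_exact_le (q : Set.Icc (0 : ℚ) 1) : IsClopen {x : Gam | exact q ≤ x} := by
  have ho : IsOpen {x : Gam | exact q ≤ x} :=
    TopologicalSpace.isOpen_generateFrom_of_mem (Or.inl ⟨q, rfl⟩)
  refine ⟨⟨?_⟩, ho⟩
  rcases eq_or_lt_of_le q.2.1 with h | h
  · have : {x : Gam | exact q ≤ x} = Set.univ :=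
      Set.eq_univ_of_forall fun x => exact_le_iff.2 (ratLE_of_nonpos h.ge x)
    rw [this, Set.compl_univ]
    exact isOpen_empty
  · have hq : ((q : ℚ) : ℝ) ∈ Set.Ioc (0 : ℝ) 1 :=
      ⟨by exact_mod_cast h, by exact_mod_cast q.2.2⟩
    have : {x : Gam | exact q ≤ x}ᶜ = Set.Iic (below ⟨(q : ℚ), hq⟩) :=
      Set.ext fun x => (not_congr exact_le_iff).trans (le_below_iff hq).symm
    rw [this]
    exact TopologicalSpace.isOpen_generateFrom_of_mem (Or.inr ⟨q, hq, rfl⟩)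

end Gam

/-! ### Measures in terms of cuts, and soundness of the rules. -/

section Soundness

variable {D : Type u} [DistribLattice D] [BoundedOrder D]

theorem IsMeasure.of_ratLE {μ : D → Gam} (mono : Monotone μ)
    (map_bot : μ ⊥ = Gam.exact ⟨0, by simp⟩) (map_top : μ ⊤ = Gam.exact ⟨1, by simp⟩)
    (h₁ : ∀ a b p q r, Gam.RatLE p (μ a) → Gam.RatLE q (μ b) → ¬ Gam.RatLE r (μ (a ⊓ b)) →
      Gam.RatLE (p + q - r) (μ (a ⊔ b)))
    (h₂ : ∀ a b s q r, Gam.RatLE s (μ (a ⊔ b)) → Gam.RatLE r (μ (a ⊓ b)) →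
      ¬ Gam.RatLE q (μ b) → Gam.RatLE (s + r - q) (μ a)) : IsMeasure μ where
  mono := mono
  map_bot := map_bot
  map_top := map_top
  miss_le_mip a b := (Gam.miss_le_mip_iff _ _).2 fun p r q hp hr hq => by
    rw [sub_add_eq_add_sub]; exact h₁ a b p q r hp hq hr
  miss_le_mip' a b := (Gam.miss_le_mip_iff _ _).2 fun s q r hs hq hr => by
    rw [sub_add_eq_add_sub]; exact h₂ a b s q r hs hr hq

theorem IsMeasure.ratLE_sup {μ : D → Gam} (hμ : IsMeasure μ) {a b : D} {p q r : ℚ}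
    (hp : Gam.RatLE p (μ a)) (hq : Gam.RatLE q (μ b)) (hr : ¬ Gam.RatLE r (μ (a ⊓ b))) :
    Gam.RatLE (p + q - r) (μ (a ⊔ b)) := by
  rw [add_sub_right_comm]
  exact (Gam.miss_le_mip_iff _ _).1 (hμ.miss_le_mip a b) p r q hp hr hq

theorem IsMeasure.ratLE_left {μ : D → Gam} (hμ : IsMeasure μ) {a b : D} {s q r : ℚ}
    (hs : Gam.RatLE s (μ (a ⊔ b))) (hr : Gam.RatLE r (μ (a ⊓ b))) (hq : ¬ Gam.RatLE q (μ b)) :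
    Gam.RatLE (s + r - q) (μ a) := by
  rw [add_sub_right_comm]
  exact (Gam.miss_le_mip_iff _ _).1 (hμ.miss_le_mip' a b) s q r hs hq hr

theorem Mea.sat_ge (μ : Mea D) {q : Set.Icc (0 : ℚ) 1} {a : D} :
    μ.Sat (.ge q a) ↔ Gam.RatLE q (μ a) := Gam.exact_le_iff

theorem Mea.sat_lt (μ : Mea D) {q : Set.Icc (0 : ℚ) 1} {a : D} :
    μ.Sat (.lt q a) ↔ ¬ Gam.RatLE q (μ a) := not_le.symm.trans (not_congr Gam.exact_le_iff)

/-- The reading of `P_{≥ s}` outside `[0,1]` agrees with cuts, which contain every `s < 0` and no `s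
> 1`. -/
theorem Mea.sat_geQ (μ : Mea D) {q : ℚ} {a : D} :
    μ.Sat (.geQ q a) ↔ Gam.RatLE q (μ a) := by
  unfold PForm.geQ
  split_ifs with h h'
  · exact μ.sat_ge
  · exact iff_of_false id fun hq => hq.le_one.not_gt h'
  · refine iff_of_true trivial (Gam.ratLE_of_nonpos (le_of_not_ge fun h0 => h ⟨h0, ?_⟩) _)
    exact not_lt.1 h'

theorem Derives.sound {Γ : Set (PForm D)} {φ : PForm D} (h : Derives Γ φ) (μ : Mea D)
    (hΓ : ∀ ψ ∈ Γ, μ.Sat ψ) : μ.Sat φ := by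
  induction h with
  | hyp h => exact hΓ _ h
  | topI => trivial
  | botE _ ih => exact (ih hΓ).elim
  | andI _ _ ih₁ ih₂ => exact ⟨ih₁ hΓ, ih₂ hΓ⟩
  | andE₁ _ ih => exact (ih hΓ).1
  | andE₂ _ ih => exact (ih hΓ).2
  | orI₁ _ ih => exact Or.inl (ih hΓ)
  | orI₂ _ ih => exact Or.inr (ih hΓ)
  | orE _ _ _ ih ih₁ ih₂ =>
    exact (ih hΓ).elim (fun h => ih₁ (Set.forall_mem_insert.2 ⟨h, hΓ⟩))
      fun h => ih₂ (Set.forall_mem_insert.2 ⟨h, hΓ⟩)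
  | negI _ ih => exact fun h => ih (Set.forall_mem_insert.2 ⟨h, hΓ⟩)
  | negE _ _ ih₁ ih₂ => exact ih₂ hΓ (ih₁ hΓ)
  | dne _ ih => exact not_not.1 (ih hΓ)
  | ge_anti h _ ih => exact μ.sat_ge.2 ((μ.sat_ge.1 (ih hΓ)).anti h)
  | ge_mono h _ ih => exact μ.sat_ge.2 ((μ.sat_ge.1 (ih hΓ)).mono (μ.2.mono h))
  | ge_zero_bot => exact μ.sat_ge.2 (Gam.ratLE_of_nonpos le_rfl _)
  | lt_bot h =>
    refine μ.sat_lt.2 fun h' => ?_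
    rw [μ.2.map_bot, Gam.ratLE_exact, Rat.cast_le] at h'
    exact h'.not_gt h
  | @ge_top _ q =>
    refine μ.sat_ge.2 ?_
    rw [μ.2.map_top, Gam.ratLE_exact, Rat.cast_le]
    exact q.2.2
  | neg_lt_of_ge _ ih => exact fun h => μ.sat_lt.1 h (μ.sat_ge.1 (ih hΓ))
  | ge_of_neg_lt _ ih => exact not_lt.1 (ih hΓ)
  | sup_or_inf _ ih =>
    obtain ⟨hp, hq⟩ := ih hΓ
    refine or_iff_not_imp_right.2 fun hr => μ.sat_geQ.2 ?_
    exact μ.2.ratLE_sup (μ.sat_ge.1 hp) (μ.sat_ge.1 hq) fun h => hr (μ.sat_ge.2 h)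
  | of_sup_and_inf h _ ih =>
    obtain ⟨hs, hr⟩ := ih hΓ
    refine or_iff_not_imp_right.2 fun hq => μ.sat_ge.2 ?_
    have := μ.2.ratLE_left (μ.sat_ge.1 hs) (μ.sat_ge.1 hr) fun h => hq (μ.sat_ge.2 h)
    simpa using this

end Soundness

/-! ### Stone duality for Boolean algebras. -/

section PrimeFilter

variable {B : Type u} [BooleanAlgebra B]

/-- `IsPrime` asks that the complement be an ideal: `⊥` makes it nonempty, and directedness is
closure under joins. -/
theorem isPrime_iff {F : Order.PFilter B} :
    F.IsPrime ↔ ⊥ ∉ F ∧ ∀ a b, a ⊔ b ∈ F → a ∈ F ∨ b ∈ F := by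
  constructor
  · rintro ⟨hl, ⟨x, hx⟩, hd⟩
    refine ⟨hl bot_le hx, fun a b hab => ?_⟩
    by_contra! hc
    obtain ⟨c, hcF, hac, hbc⟩ := hd a hc.1 b hc.2
    exact hcF (Order.PFilter.mem_of_le (sup_le hac hbc) hab)
  · rintro ⟨hb, hs⟩
    refine ⟨fun a b hba ha hb => ha (Order.PFilter.mem_of_le hba hb), ⟨⊥, hb⟩, ?_⟩
    exact fun a ha b hb => ⟨a ⊔ b, fun h => (hs a b h).elim ha hb, le_sup_left, le_sup_right⟩

namespace StoneSpace

/-- The prime filter with a given set of elements. -/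
def ofSet (S : Set B) (top : ⊤ ∈ S) (bot : ⊥ ∉ S) (mono : ∀ a b, a ≤ b → a ∈ S → b ∈ S)
    (inf : ∀ a b, a ∈ S → b ∈ S → a ⊓ b ∈ S) (sup : ∀ a b, a ⊔ b ∈ S → a ∈ S ∨ b ∈ S) :
    StoneSpace B :=
  ⟨(Order.IsPFilter.of_def (F := S) ⟨⊤, top⟩
    (fun a ha b hb => ⟨a ⊓ b, inf a b ha hb, inf_le_left, inf_le_right⟩)
    fun {a b} hab ha => mono a b hab ha).toPFilter, isPrime_iff.2 ⟨bot, sup⟩⟩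

theorem ext_mem {F G : StoneSpace B} (h : ∀ a, a ∈ F.1 ↔ a ∈ G.1) : F = G :=
  Subtype.ext (SetLike.ext h)

theorem bot_notMem (F : StoneSpace B) : ⊥ ∉ F.1 := (isPrime_iff.1 F.2).1

theorem sup_mem_iff (F : StoneSpace B) {a b : B} : a ⊔ b ∈ F.1 ↔ a ∈ F.1 ∨ b ∈ F.1 :=
  ⟨(isPrime_iff.1 F.2).2 a b, fun h => h.elim (Order.PFilter.mem_of_le le_sup_left)
    (Order.PFilter.mem_of_le le_sup_right)⟩

theorem inf_mem_iff (F : StoneSpace B) {a b : B} : a ⊓ b ∈ F.1 ↔ a ∈ F.1 ∧ b ∈ F.1 :=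
  Order.PFilter.inf_mem_iff

theorem compl_mem_iff (F : StoneSpace B) {a : B} : aᶜ ∈ F.1 ↔ a ∉ F.1 := by
  refine ⟨fun h h' => F.bot_notMem ?_, fun h => ?_⟩
  · rw [← inf_compl_self a]
    exact Order.PFilter.inf_mem h' h
  · have : a ⊔ aᶜ ∈ F.1 := by rw [sup_compl_eq_top]; exact Order.PFilter.top_mem
    exact (F.sup_mem_iff.1 this).resolve_left h

/-- The prime ideal theorem, applied to the filter generated by `a` and the ideal generated by `b`.
-/
theorem exists_mem_notMem {a b : B} (h : ¬ a ≤ b) : ∃ F : StoneSpace B, a ∈ F.1 ∧ b ∉ F.1 := by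
  have hd : Disjoint (Order.PFilter.principal a : Set B) (Order.Ideal.principal b : Set B) :=
    Set.disjoint_left.2 fun x hx hx' =>
      h ((Order.PFilter.mem_principal.1 hx).trans (Order.Ideal.mem_principal.1 hx'))
  obtain ⟨J, hJ, hIJ, hFJ⟩ := DistribLattice.prime_ideal_of_disjoint_filter_ideal hd
  refine ⟨⟨hJ.toPrimePair.F, hJ.toPrimePair.F_isPrime⟩, ?_, ?_⟩
  · change a ∈ (J : Set B)ᶜ
    exact fun ha => Set.disjoint_left.1 hFJ (Order.PFilter.mem_principal.2 le_rfl) ha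
  · change ¬ b ∈ (J : Set B)ᶜ
    exact fun hb => hb (hIJ (Order.Ideal.mem_principal.2 le_rfl))

theorem isOpen_setOf_mem (a : B) : IsOpen {F : StoneSpace B | a ∈ F.1} :=
  TopologicalSpace.isOpen_generateFrom_of_mem (Or.inl ⟨a, rfl⟩)

theorem isClopen_setOf_mem (a : B) : IsClopen {F : StoneSpace B | a ∈ F.1} :=
  ⟨⟨TopologicalSpace.isOpen_generateFrom_of_mem (Or.inr ⟨a, rfl⟩)⟩, isOpen_setOf_mem a⟩

theorem isTopologicalBasis :
    TopologicalSpace.IsTopologicalBasis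
      (Set.range fun a : B => {F : StoneSpace B | a ∈ F.1}) := by
  refine TopologicalSpace.isTopologicalBasis_of_subbasis_of_finiteInter ?_ ⟨?_, ?_⟩
  · change TopologicalSpace.generateFrom _ = _
    congr 1
    refine subset_antisymm (Set.union_subset ?_ ?_) ?_
    · rintro _ ⟨a, rfl⟩; exact ⟨a, rfl⟩
    · rintro _ ⟨a, rfl⟩; exact ⟨aᶜ, Set.ext fun F => F.compl_mem_iff⟩
    · rintro _ ⟨a, rfl⟩; exact Or.inl ⟨a, rfl⟩
  · exact ⟨⊤, Set.eq_univ_of_forall fun F => Order.PFilter.top_mem⟩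
  · rintro _ ⟨a, rfl⟩ _ ⟨b, rfl⟩
    exact ⟨a ⊓ b, Set.ext fun F => F.inf_mem_iff⟩

instance : CompactSpace (StoneSpace B) := by
  refine ⟨isCompact_iff_ultrafilter_le_nhds.2 fun U _ => ?_⟩
  -- The limit of `U` consists of the elements lying in `U`-almost every prime filter; it is prime
  -- because an ultrafilter decides disjunctions.
  let F : StoneSpace B := ofSet {a | ∀ᶠ G : StoneSpace B in U, a ∈ G.1}
    (Filter.Eventually.of_forall fun G => Order.PFilter.top_mem)
    (fun h => h.exists.elim fun G hG => G.bot_notMem hG)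
    (fun a b hab h => h.mono fun G hG => Order.PFilter.mem_of_le hab hG)
    (fun a b ha hb => (ha.and hb).mono fun G hG => G.inf_mem_iff.2 hG)
    (fun a b h => Ultrafilter.eventually_or.1 (h.mono fun G hG => G.sup_mem_iff.1 hG))
  refine ⟨F, trivial, (isTopologicalBasis.nhds_hasBasis (a := F)).ge_iff.2 ?_⟩
  rintro _ ⟨⟨a, rfl⟩, ha⟩
  exact ha

instance : TotallySeparatedSpace (StoneSpace B) := by
  refine totallySeparatedSpace_iff_exists_isClopen.2 fun F G hne => ?_
  obtain ⟨a, ha⟩ : ∃ a, ¬ (a ∈ F.1 ↔ a ∈ G.1) := by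
    by_contra! h
    exact hne (ext_mem h)
  by_cases hF : a ∈ F.1
  · exact ⟨_, isClopen_setOf_mem a, hF, fun hG => ha (iff_of_true hF hG)⟩
  · exact ⟨_, (isClopen_setOf_mem a).compl, hF, fun hG => ha (iff_of_false hF hG)⟩

/-- A clopen set is compact and is a union of basic sets, hence a finite union; finite unions
correspond to joins. -/
theorem exists_eq_of_isClopen {C : Set (StoneSpace B)} (hC : IsClopen C) :
    ∃ a : B, {F : StoneSpace B | a ∈ F.1} = C := by
  have h := hC.isClosed.isCompact
  refine h.induction_on (p := fun K => ∃ a : B, K ⊆ {F | a ∈ F.1} ∧ {F | a ∈ F.1} ⊆ C)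
    ⟨⊥, Set.empty_subset _, by rintro F hF; exact (F.bot_notMem hF).elim⟩
    (fun K K' hK ⟨a, h, h'⟩ => ⟨a, hK.trans h, h'⟩) ?_ ?_ |>.imp fun a ha => ha.2.antisymm ha.1
  · rintro K K' ⟨a, h, h'⟩ ⟨b, k, k'⟩
    refine ⟨a ⊔ b, Set.union_subset (fun F hF => F.sup_mem_iff.2 (Or.inl (h hF)))
      fun F hF => F.sup_mem_iff.2 (Or.inr (k hF)), fun F hF => ?_⟩
    exact (F.sup_mem_iff.1 hF).elim (fun hF => h' hF) fun hF => k' hF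
  · intro F hF
    obtain ⟨_, ⟨a, rfl⟩, ha, haC⟩ := isTopologicalBasis.exists_subset_of_mem_open hF hC.isOpen
    exact ⟨_, mem_nhdsWithin_of_mem_nhds ((isOpen_setOf_mem a).mem_nhds ha), a, subset_rfl, haC⟩

end StoneSpace

end PrimeFilter

/-! ### Completeness, and measures as prime filters. -/

section Completeness

variable {D : Type u} [DistribLattice D] [BoundedOrder D]

theorem Entails.geQ_anti {p q : ℚ} (h : p ≤ q) (a : D) :
    Entails (PForm.geQ q a) (PForm.geQ p a) := by
  unfold PForm.geQ
  split_ifs with hq hp h1 h1 hp h2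
  · exact .ge_anti h (.hyp rfl)
  · exact absurd (h.trans hq.2) h1.not_ge
  · exact .topI
  · exact .botE (.hyp rfl)
  · exact .botE (.hyp rfl)
  · exact .botE (.hyp rfl)
  · exact (hq ⟨(‹p ∈ Set.Icc (0 : ℚ) 1› : _).1.trans h, not_lt.1 h1⟩).elim
  · exact absurd (lt_of_lt_of_le ‹1 < p› h) h1
  · exact .topI

theorem Entails.geQ_mono (q : ℚ) {a b : D} (h : a ≤ b) :
    Entails (PForm.geQ q a) (PForm.geQ q b) := by
  unfold PForm.geQ
  split_ifs
  · exact .ge_mono h (.hyp rfl)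
  · exact .refl _
  · exact .refl _

namespace StoneSpace

variable (F : StoneSpace (LTAlg D))

theorem mem_of_entails {F : StoneSpace (LTAlg D)} {φ ψ : PForm D} (h : Entails φ ψ)
    (hφ : LTAlg.mk φ ∈ F.1) : LTAlg.mk ψ ∈ F.1 :=
  Order.PFilter.mem_of_le (x := LTAlg.mk φ) (y := LTAlg.mk ψ) h hφ

theorem mk_mem_of_derives {φ : PForm D} (h : Derives ∅ φ) : LTAlg.mk φ ∈ F.1 :=
  mem_of_entails (φ := .top) (h.weaken (Set.empty_subset _)) Order.PFilter.top_mem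

theorem mk_top_mem : LTAlg.mk PForm.top ∈ F.1 := Order.PFilter.top_mem

theorem mk_bot_notMem : LTAlg.mk PForm.bot ∉ F.1 := F.bot_notMem

theorem mk_and_mem_iff {φ ψ : PForm D} :
    LTAlg.mk (φ.and ψ) ∈ F.1 ↔ LTAlg.mk φ ∈ F.1 ∧ LTAlg.mk ψ ∈ F.1 :=
  F.inf_mem_iff (a := LTAlg.mk φ) (b := LTAlg.mk ψ)

theorem mk_or_mem_iff {φ ψ : PForm D} :
    LTAlg.mk (φ.or ψ) ∈ F.1 ↔ LTAlg.mk φ ∈ F.1 ∨ LTAlg.mk ψ ∈ F.1 :=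
  F.sup_mem_iff (a := LTAlg.mk φ) (b := LTAlg.mk ψ)

theorem mk_neg_mem_iff {φ : PForm D} : LTAlg.mk φ.neg ∈ F.1 ↔ LTAlg.mk φ ∉ F.1 :=
  F.compl_mem_iff (a := LTAlg.mk φ)

theorem mk_lt_mem_iff {q : Set.Icc (0 : ℚ) 1} {a : D} :
    LTAlg.mk (.lt q a) ∈ F.1 ↔ LTAlg.mk (.ge q a) ∉ F.1 := by
  rw [← not_iff_not, not_not, ← mk_neg_mem_iff]
  exact ⟨mem_of_entails (.ge_of_neg_lt (.hyp rfl)), mem_of_entails (.neg_lt_of_ge (.hyp rfl))⟩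

/-- The value at `a` of the measure to be built: the indices `q` for which the filter accepts `P_{≥
q} a` form a cut. -/
theorem exists_ratLE_iff_mem (a : D) :
    ∃ x : Gam, ∀ q, Gam.RatLE q x ↔ LTAlg.mk (.geQ q a) ∈ F.1 := by
  have h0 : LTAlg.mk (.geQ 0 a) ∈ F.1 := by
    refine F.mk_mem_of_derives ?_
    rw [PForm.geQ, dif_pos ⟨le_rfl, zero_le_one⟩]
    exact .ge_mono bot_le .ge_zero_bot
  refine Gam.exists_ratLE_iff _ (fun p q h hq => mem_of_entails (.geQ_anti h a) hq)
    (fun q hq => mem_of_entails (.geQ_anti hq a) h0) fun q hq => ?_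
  by_contra h1
  rw [PForm.geQ, dif_neg fun h => h1 h.2, if_pos (not_le.1 h1)] at hq
  exact F.mk_bot_notMem hq

/-- Primality of the filter turns the last two rules into the measure inequalities. The rules have
indices in `[0,1]` while cuts involve all rationals; the remaining indices follow from monotonicity
or are trivial. -/
theorem isMeasure_of_ratLE_iff_mem {μ : D → Gam}
    (hμ : ∀ a q, Gam.RatLE q (μ a) ↔ LTAlg.mk (.geQ q a) ∈ F.1) : IsMeasure μ := by
  have hge : ∀ a (q : Set.Icc (0 : ℚ) 1), Gam.RatLE q (μ a) ↔ LTAlg.mk (.ge q a) ∈ F.1 := by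
    intro a q
    rw [hμ, PForm.geQ, dif_pos q.2]
  have mono : Monotone μ := fun a b h =>
    Gam.le_iff_ratLE.2 fun q hq => (hμ b q).2 (mem_of_entails (.geQ_mono q h) ((hμ a q).1 hq))
  refine .of_ratLE mono ?_ ?_ ?_ ?_
  · refine Gam.ext_ratLE fun q => ?_
    rw [Gam.ratLE_exact, Rat.cast_le]
    refine ⟨fun h => ?_, fun h => Gam.ratLE_of_nonpos h _⟩
    by_contra hq
    have hq' := not_le.1 hq
    let q' : Set.Icc (0 : ℚ) 1 := ⟨q, hq'.le, h.le_one⟩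
    exact F.mk_lt_mem_iff.1 (F.mk_mem_of_derives (.lt_bot (q := q') hq')) ((hge ⊥ q').1 h)
  · refine Gam.ext_ratLE fun q => ?_
    rw [Gam.ratLE_exact, Rat.cast_le]
    refine ⟨Gam.RatLE.le_one, fun h => ?_⟩
    exact ((hge ⊤ ⟨1, zero_le_one, le_rfl⟩).2 (F.mk_mem_of_derives .ge_top)).anti h
  · intro a b p q r hp hq hr
    have hpb := hp.mono (mono (le_sup_left : a ≤ a ⊔ b))
    have hqb := hq.mono (mono (le_sup_right : b ≤ a ⊔ b))
    have hr0 := Gam.pos_of_not_ratLE hr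
    -- With `r > 0` and `p, q ≤ 1`, an index out of range makes `p + q - r` at most `q` or at most
    -- `p`.
    rcases lt_or_ge p 0 with hp0 | hp0
    · exact hqb.anti (by linarith)
    rcases lt_or_ge q 0 with hq0 | hq0
    · exact hpb.anti (by linarith)
    rcases lt_or_ge 1 r with hr1 | hr1
    · exact hpb.anti (by linarith [hq.le_one])
    have h := mem_of_entails (F := F) (.sup_or_inf (r := ⟨r, hr0.le, hr1⟩) (.hyp rfl))
      (F.mk_and_mem_iff.2 ⟨(hge a ⟨p, hp0, hp.le_one⟩).1 hp, (hge b ⟨q, hq0, hq.le_one⟩).1 hq⟩)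
    refine (hμ _ _).2 ((F.mk_or_mem_iff.1 h).resolve_right fun h => hr ?_)
    exact (hge (a ⊓ b) ⟨r, hr0.le, hr1⟩).2 h
  · intro a b s q r hs hr hq
    -- Raising a negative `r` to `0` keeps the hypothesis and strengthens the conclusion.
    wlog hr0 : 0 ≤ r generalizing r
    · exact (this 0 (Gam.ratLE_of_nonpos le_rfl _) le_rfl).anti (by linarith)
    have hra := hr.mono (mono (inf_le_left : a ⊓ b ≤ a))
    have hrq := (hr.mono (mono (inf_le_right : a ⊓ b ≤ b))).lt hq
    have hq0 := Gam.pos_of_not_ratLE hq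
    rcases lt_or_ge 1 q with hq1 | hq1
    · exact hra.anti (by linarith [hs.le_one])
    rcases lt_or_ge s 0 with hs0 | hs0
    · exact hra.anti (by linarith)
    -- The index `p` of the conclusion is solved for, to match the rule; `p ≤ 1` will follow from `s
    -- ≤ 1` and `r < q`.
    obtain ⟨p, rfl⟩ : ∃ p, s = p + q - r := ⟨s + r - q, by ring⟩
    rw [show p + q - r + r - q = p by ring]
    rcases lt_or_ge p 0 with hp0 | hp0
    · exact Gam.ratLE_of_nonpos hp0.le _
    have hr1 := hr.le_one
    have hs1 := hs.le_one
    lift p to Set.Icc (0 : ℚ) 1 using ⟨hp0, by linarith⟩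
    lift q to Set.Icc (0 : ℚ) 1 using ⟨hq0.le, hq1⟩
    lift r to Set.Icc (0 : ℚ) 1 using ⟨hr0, hr1⟩
    have h := mem_of_entails (F := F) (.of_sup_and_inf (p := p) (q := q) (r := r) (a := a) (b := b)
      ⟨hs0, hs1⟩ (.hyp rfl)) (F.mk_and_mem_iff.2 ⟨(hge _ ⟨_, hs0, hs1⟩).1 hs, (hge _ r).1 hr⟩)
    exact (hge a p).2 ((F.mk_or_mem_iff.1 h).resolve_right fun h => hq ((hge b q).2 h))

/-- Every prime filter of the Lindenbaum-Tarski algebra is the theory of a measure. -/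
theorem exists_mea : ∃ μ : Mea D, ∀ φ : PForm D, LTAlg.mk φ ∈ F.1 ↔ μ.Sat φ := by
  choose μ hμ using F.exists_ratLE_iff_mem
  obtain ⟨μ, rfl⟩ : ∃ ν : Mea D, ν.1 = μ := ⟨⟨μ, F.isMeasure_of_ratLE_iff_mem hμ⟩, rfl⟩
  refine ⟨μ, fun φ => ?_⟩
  have hge : ∀ (q : Set.Icc (0 : ℚ) 1) a, LTAlg.mk (.ge q a) ∈ F.1 ↔ Gam.RatLE q (μ a) := by
    intro q a
    rw [hμ, PForm.geQ, dif_pos q.2]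
  induction φ with
  | ge q a => exact (hge q a).trans μ.sat_ge.symm
  | lt q a => exact F.mk_lt_mem_iff.trans ((not_congr (hge q a)).trans μ.sat_lt.symm)
  | top => exact iff_of_true F.mk_top_mem trivial
  | bot => exact iff_of_false F.mk_bot_notMem id
  | and φ ψ ih₁ ih₂ => exact F.mk_and_mem_iff.trans (and_congr ih₁ ih₂)
  | or φ ψ ih₁ ih₂ => exact F.mk_or_mem_iff.trans (or_congr ih₁ ih₂)
  | neg φ ih => exact F.mk_neg_mem_iff.trans (not_congr ih)

end StoneSpace

theorem Mea.ext_sat {μ ν : Mea D} (h : ∀ φ, μ.Sat φ ↔ ν.Sat φ) : μ = ν := by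
  refine Subtype.ext (funext fun a => Gam.ext_ratLE fun q => ?_)
  exact μ.sat_geQ.symm.trans ((h _).trans ν.sat_geQ)

/-- The theory of a measure, as a prime filter of the Lindenbaum-Tarski algebra. -/
def Mea.theory (μ : Mea D) : StoneSpace (LTAlg D) :=
  .ofSet {x | Quotient.lift (s := provSetoid D) μ.Sat
      (fun _ _ h => propext ⟨fun k => h.1.sound μ (by simpa using k),
        fun k => h.2.sound μ (by simpa using k)⟩) x}
    trivial id
    (by rintro ⟨φ⟩ ⟨ψ⟩ h k; exact Derives.sound h μ (by rintro _ rfl; exact k))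
    (by rintro ⟨φ⟩ ⟨ψ⟩ h k; exact ⟨h, k⟩)
    (by rintro ⟨φ⟩ ⟨ψ⟩ h; exact h)

theorem Mea.mk_mem_theory {μ : Mea D} {φ : PForm D} : LTAlg.mk φ ∈ μ.theory.1 ↔ μ.Sat φ := Iff.rfl

theorem Mea.theory_bijective : Function.Bijective (Mea.theory (D := D)) := by
  refine ⟨fun μ ν h => Mea.ext_sat fun φ => ?_, fun F => ?_⟩
  · rw [← Mea.mk_mem_theory, h, Mea.mk_mem_theory]
  · obtain ⟨μ, hμ⟩ := F.exists_mea
    exact ⟨μ, StoneSpace.ext_mem (by rintro ⟨φ⟩; exact (hμ φ).symm)⟩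

theorem Mea.isClopen_setOf_sat (φ : PForm D) : IsClopen {μ : Mea D | μ.Sat φ} := by
  have hge : ∀ (q : Set.Icc (0 : ℚ) 1) a, IsClopen {μ : Mea D | μ.Sat (.ge q a)} := fun q a =>
    (Gam.isClopen_setOf_exact_le q).preimage
      ((continuous_apply a).comp (continuous_subtype_val (p := IsMeasure (D := D))))
  induction φ with
  | ge q a => exact hge q a
  | lt q a =>
    have : {μ : Mea D | μ.Sat (.lt q a)} = {μ : Mea D | μ.Sat (.ge q a)}ᶜ :=
      Set.ext fun μ => μ.sat_lt.trans (not_congr μ.sat_ge).symm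
    rw [this]
    exact (hge q a).compl
  | top => exact isClopen_univ
  | bot => exact isClopen_empty
  | and φ ψ ih₁ ih₂ => exact ih₁.inter ih₂
  | or φ ψ ih₁ ih₂ => exact ih₁.union ih₂
  | neg φ ih => exact ih.compl

variable (D) in
/-- The space of measures is the space of prime filters of the Lindenbaum-Tarski algebra. -/
noncomputable def Mea.homeomorph : Mea D ≃ₜ StoneSpace (LTAlg D) where
  toEquiv := Equiv.ofBijective Mea.theory Mea.theory_bijective
  continuous_toFun := by
    refine StoneSpace.isTopologicalBasis.continuous_iff.2 ?_
    rintro _ ⟨⟨φ⟩, rfl⟩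
    exact (Mea.isClopen_setOf_sat φ).isOpen
  continuous_invFun := by
    set e := Equiv.ofBijective (Mea.theory (D := D)) Mea.theory_bijective
    have he : ∀ F φ, LTAlg.mk φ ∈ F.1 ↔ (e.symm F).Sat φ := fun F φ => by
      rw [← Mea.mk_mem_theory]
      exact iff_of_eq (congrArg (LTAlg.mk φ ∈ ·.1) (e.apply_symm_apply F).symm)
    have hc : ∀ φ, IsOpen {F | (e.symm F).Sat φ} := fun φ => by
      simp only [← he]
      exact StoneSpace.isOpen_setOf_mem _
    refine continuous_induced_rng.2 (continuous_pi fun a => continuous_generateFrom_iff.2 ?_)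
    -- The two kinds of subbasic sets at coordinate `a` are defined by the atoms `P_{≥ p} a` and
    -- `P_{< q} a`.
    rintro _ (⟨p, rfl⟩ | ⟨q, hq, rfl⟩)
    · exact hc (.ge p a)
    · have hq' : q ∈ Set.Icc (0 : ℚ) 1 := ⟨by exact_mod_cast hq.1.le, by exact_mod_cast hq.2⟩
      convert! hc (.lt ⟨q, hq'⟩ a) using 1
      refine Set.ext fun F => (Gam.le_below_iff hq).trans ?_
      exact (Mea.sat_lt (q := ⟨q, hq'⟩) (a := a) (e.symm F)).symm

theorem Mea.mk_mem_homeomorph (μ : Mea D) (φ : PForm D) :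
    LTAlg.mk φ ∈ (Mea.homeomorph D μ).1 ↔ μ.Sat φ := Iff.rfl

instance : CompactSpace (Mea D) := (Mea.homeomorph D).symm.compactSpace

instance : TotallySeparatedSpace (Mea D) := by
  refine totallySeparatedSpace_iff_exists_isClopen.2 fun μ ν hne => ?_
  obtain ⟨U, hU, hμ, hν⟩ := totallySeparatedSpace_iff_exists_isClopen.1
    (inferInstanceAs (TotallySeparatedSpace (StoneSpace (LTAlg D))))
    ((Mea.homeomorph D).injective.ne hne)
  exact ⟨_, hU.preimage (Mea.homeomorph D).continuous, hμ, hν⟩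

/-- Completeness: a formula entails those that hold in all the measures where it holds. -/
theorem entails_iff {φ ψ : PForm D} : Entails φ ψ ↔ ∀ μ : Mea D, μ.Sat φ → μ.Sat ψ := by
  refine ⟨fun h μ hφ => h.sound μ (by rintro _ rfl; exact hφ), fun h => ?_⟩
  by_contra hc
  -- A prime filter separating `φ` from `ψ` is the theory of a measure, which is the countermodel.
  obtain ⟨F, hφ, hψ⟩ := StoneSpace.exists_mem_notMem (a := LTAlg.mk φ) (b := LTAlg.mk ψ) hc
  obtain ⟨μ, hμ⟩ := F.exists_mea
  exact hψ ((hμ ψ).2 (h μ ((hμ φ).1 hφ)))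

theorem Mea.exists_sat_of_isClopen {C : Set (Mea D)} (hC : IsClopen C) :
    ∃ φ : PForm D, {μ : Mea D | μ.Sat φ} = C := by
  obtain ⟨⟨φ⟩, hφ⟩ :=
    StoneSpace.exists_eq_of_isClopen (hC.preimage (Mea.homeomorph D).symm.continuous)
  refine ⟨φ, Set.ext fun μ => ?_⟩
  have := Set.ext_iff.1 hφ (Mea.homeomorph D μ)
  rw [Set.mem_preimage, Homeomorph.symm_apply_apply] at this
  exact this

/-- The Lindenbaum-Tarski algebra is the algebra of clopen sets of measures. -/
theorem exists_orderIso_clopens (D : Type u) [DistribLattice D] [BoundedOrder D] :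
    ∃ e : LTAlg D ≃o TopologicalSpace.Clopens (Mea D),
      ∀ φ : PForm D, (e (LTAlg.mk φ) : Set (Mea D)) = {μ | μ.Sat φ} := by
  let f : LTAlg D → TopologicalSpace.Clopens (Mea D) :=
    Quotient.lift (s := provSetoid D) (fun φ => ⟨{μ | μ.Sat φ}, Mea.isClopen_setOf_sat φ⟩)
      fun φ ψ h => TopologicalSpace.Clopens.ext
        (Set.ext fun μ => ⟨entails_iff.1 h.1 μ, entails_iff.1 h.2 μ⟩)
  have hf : ∀ x y, f x ≤ f y ↔ x ≤ y := by
    rintro ⟨φ⟩ ⟨ψ⟩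
    exact (entails_iff (φ := φ) (ψ := ψ)).symm
  refine ⟨RelIso.ofSurjective (OrderEmbedding.ofMapLEIff f hf) ?_, fun φ => rfl⟩
  intro C
  obtain ⟨φ, hφ⟩ := Mea.exists_sat_of_isClopen C.isClopen
  exact ⟨LTAlg.mk φ, TopologicalSpace.Clopens.ext hφ⟩

end Completeness

/-! ### The Stone pairing with finite structures. -/

section FiniteStructures

open FirstOrder FirstOrder.Language

variable {L : FirstOrder.Language.{u, v}}

theorem FinStr.pairing_eq_prob (A : FinStr.{u, v, w} L) {n : ℕ} {φ : L.Formula ℕ}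
    {ψ : L.Formula (Fin n)}
    (h : ∀ x : ℕ → A.carrier, ψ.Realize (fun i => x i) ↔ φ.Realize x) :
    A.pairing (FO.mk φ) = A.prob n ψ :=
  A.prob_eq _ _ _ _ fun x => (realize_restrictVars φ x).trans (h x).symm

theorem exists_realize_iff (φ : L.Formula ℕ) {n : ℕ} (hn : varBound φ ≤ n) :
    ∃ ψ : L.Formula (Fin n), ∀ (A : FinStr.{u, v, w} L) (x : ℕ → A.carrier),
      ψ.Realize (fun i => x i) ↔ φ.Realize x :=
  ⟨(restrictVars φ).relabel (Fin.castLE hn), fun A x => by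
    rw [Formula.realize_relabel, ← realize_restrictVars]
    rfl⟩

theorem FinStr.prob_mono (A : FinStr.{u, v, w} L) {n : ℕ} {φ ψ : L.Formula (Fin n)}
    (h : ∀ a : Fin n → A.carrier, φ.Realize a → ψ.Realize a) : A.prob n φ ≤ A.prob n ψ := by
  unfold FinStr.prob
  gcongr
  exact Nat.card_le_card_of_injective (Subtype.map id h)
    (Subtype.map_injective h Function.injective_id)

theorem FinStr.prob_sup_add_prob_inf (A : FinStr.{u, v, w} L) {n : ℕ} (φ ψ : L.Formula (Fin n)) :
    A.prob n (φ ⊔ ψ) + A.prob n (φ ⊓ ψ) = A.prob n φ + A.prob n ψ := by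
  have h := Set.ncard_union_add_ncard_inter {a : Fin n → A.carrier | φ.Realize a}
    {a | ψ.Realize a}
  unfold FinStr.prob
  rw [← add_div, ← add_div]
  congr 1
  simp only [Formula.realize_sup, Formula.realize_inf]
  exact_mod_cast h

/-- Reading two classes in a common set of variables reduces identities for the pairing to counting
in a single power of `A`. -/
theorem FinStr.exists_prob_eq (A : FinStr.{u, v, w} L) (d e : FO L) :
    ∃ (n : ℕ) (φ ψ : L.Formula (Fin n)), A.pairing d = A.prob n φ ∧ A.pairing e = A.prob n ψ ∧
      A.pairing (d ⊔ e) = A.prob n (φ ⊔ ψ) ∧ A.pairing (d ⊓ e) = A.prob n (φ ⊓ ψ) := by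
  rcases d with ⟨φ⟩
  rcases e with ⟨ψ⟩
  obtain ⟨φ', h⟩ := exists_realize_iff φ (le_max_left (varBound φ) (varBound ψ))
  obtain ⟨ψ', h'⟩ := exists_realize_iff ψ (le_max_right (varBound φ) (varBound ψ))
  refine ⟨_, φ', ψ', A.pairing_eq_prob (h A), A.pairing_eq_prob (h' A),
    A.pairing_eq_prob (φ := φ ⊔ ψ) fun x => ?_, A.pairing_eq_prob (φ := φ ⊓ ψ) fun x => ?_⟩
  · rw [Formula.realize_sup, Formula.realize_sup, h, h']
  · rw [Formula.realize_inf, Formula.realize_inf, h, h']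

theorem FinStr.pairing_sup_add_pairing_inf (A : FinStr.{u, v, w} L) (d e : FO L) :
    A.pairing (d ⊔ e) + A.pairing (d ⊓ e) = A.pairing d + A.pairing e := by
  obtain ⟨n, φ, ψ, h₁, h₂, h₃, h₄⟩ := A.exists_prob_eq d e
  rw [h₁, h₂, h₃, h₄, A.prob_sup_add_prob_inf]

theorem FinStr.pairing_mono (A : FinStr.{u, v, w} L) : Monotone A.pairing := by
  intro d e h
  obtain ⟨n, φ, ψ, -, h₂, -, h₄⟩ := A.exists_prob_eq d e
  -- Replacing `d` by `d ⊓ e` makes the inclusion of solution sets evident.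
  rw [← inf_eq_left.2 h, h₂, h₄]
  exact A.prob_mono fun a ha => (Formula.realize_inf.1 ha).2

theorem FinStr.pairing_bot (A : FinStr.{u, v, w} L) : A.pairing ⊥ = 0 := by
  have : A.pairing (FO.mk ⊥) = A.prob 0 ⊥ :=
    A.pairing_eq_prob fun x => by rw [Formula.realize_bot, Formula.realize_bot]
  refine this.trans ?_
  simp [FinStr.prob, Formula.realize_bot]

theorem FinStr.pairing_top (A : FinStr.{u, v, w} L) : A.pairing ⊤ = 1 := by
  have : A.pairing (FO.mk ⊤) = A.prob 0 ⊤ :=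
    A.pairing_eq_prob fun x => by rw [Formula.realize_top, Formula.realize_top]
  refine this.trans ?_
  simp [FinStr.prob, Formula.realize_top]

theorem FinStr.ratLE_gammaPairing (A : FinStr.{u, v, w} L) {q : ℚ} {d : FO L} :
    Gam.RatLE q (A.gammaPairing d) ↔ q ≤ A.pairing d := Rat.cast_le

/-- For exact values both conditions are linear consequences of modularity. -/
theorem FinStr.isMeasure_gammaPairing (A : FinStr.{u, v, w} L) : IsMeasure A.gammaPairing := by
  refine .of_ratLE (fun d e h => Gam.le_iff_ratLE.2 fun q => ?_) ?_ ?_ ?_ ?_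
  · simp only [A.ratLE_gammaPairing]
    exact fun hq => hq.trans (A.pairing_mono h)
  · exact congrArg Gam.exact (Subtype.ext A.pairing_bot)
  · exact congrArg Gam.exact (Subtype.ext A.pairing_top)
  · intro d e p q r
    simp only [A.ratLE_gammaPairing]
    intro hp hq hr
    linarith [A.pairing_sup_add_pairing_inf d e]
  · intro d e s q r
    simp only [A.ratLE_gammaPairing]
    intro hs hr hq
    linarith [A.pairing_sup_add_pairing_inf d e]

/-- The `Γ`-valued Stone pairing with a finite structure, as a measure. -/
noncomputable def FinStr.mea (A : FinStr.{u, v, w} L) : Mea (FO L) :=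
  ⟨A.gammaPairing, A.isMeasure_gammaPairing⟩

theorem FinStr.sat_mea_iff (A : FinStr.{u, v, w} L) (φ : PForm (FO L)) :
    A.mea.Sat φ ↔ A.Sat φ := by
  induction φ with
  | ge q d => exact A.mea.sat_ge.trans A.ratLE_gammaPairing
  | lt q d => exact A.mea.sat_lt.trans ((not_congr A.ratLE_gammaPairing).trans not_le)
  | top => exact Iff.rfl
  | bot => exact Iff.rfl
  | and φ ψ ih₁ ih₂ => exact and_congr ih₁ ih₂
  | or φ ψ ih₁ ih₂ => exact or_congr ih₁ ih₂
  | neg φ ih => exact not_congr ih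

theorem FinStr.pairing_congr {A B : FinStr.{u, v, w} L} (e : A.carrier ≃[L] B.carrier) (d : FO L) :
    A.pairing d = B.pairing d := by
  rcases d with ⟨φ⟩
  change A.prob _ (restrictVars φ) = B.prob _ (restrictVars φ)
  unfold FinStr.prob
  rw [Nat.card_congr e.toEquiv]
  congr 2
  refine Nat.card_congr ((Equiv.arrowCongr (Equiv.refl _) e.toEquiv).subtypeEquiv fun a => ?_)
  exact (StrongHomClass.realize_formula e (restrictVars φ)).symm

theorem FinStr.mea_congr {A B : FinStr.{u, v, w} L} (e : A.carrier ≃[L] B.carrier) :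
    A.mea = B.mea :=
  Subtype.ext (funext fun d => congrArg Gam.exact (Subtype.ext (FinStr.pairing_congr e d)))

theorem FinStr.prob_eq_zero_iff (A : FinStr.{u, v, w} L) {n : ℕ} {φ : L.Formula (Fin n)} :
    A.prob n φ = 0 ↔ ∀ a : Fin n → A.carrier, ¬ φ.Realize a := by
  have h0 : (Nat.card A.carrier : ℚ) ≠ 0 := by exact_mod_cast Nat.card_pos.ne'
  rw [FinStr.prob, div_eq_zero_iff, or_iff_left (pow_ne_zero _ h0), Nat.cast_eq_zero,
    Finite.card_eq_zero_iff, isEmpty_subtype]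

/-- If each of the finitely many tuples `b` failed some formula true of `a`, the conjunction of
these formulas would have probability zero in `B` but not in `A`. -/
theorem FinStr.exists_realize_of_pairing_eq {A B : FinStr.{u, v, w} L}
    (h : A.pairing = B.pairing) {n : ℕ} (a : Fin n → A.carrier) :
    ∃ b : Fin n → B.carrier, ∀ φ : L.Formula (Fin n), φ.Realize a ↔ φ.Realize b := by
  -- One direction suffices, by passing to negations.
  suffices ∃ b : Fin n → B.carrier, ∀ φ : L.Formula (Fin n), φ.Realize a → φ.Realize b by
    refine this.imp fun b hb φ => ⟨hb φ, fun hφ => ?_⟩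
    by_contra hc
    exact hb φ.not hc hφ
  by_contra! hc
  choose φ hφ hφ' using hc
  have hB : B.prob n (Formula.iInf φ) = 0 :=
    B.prob_eq_zero_iff.2 fun b hb => hφ' b (Formula.realize_iInf.1 hb b)
  rw [← FinStr.pairing_mk, ← h, FinStr.pairing_mk, FinStr.prob_eq_zero_iff] at hB
  exact hB a (Formula.realize_iInf.2 hφ)

/-- A tuple enumerating `A` and its match in `B` satisfy the same atomic formulas: equalities give
injectivity, and the others preservation of functions and relations. -/
theorem FinStr.nonempty_embedding_of_pairing_eq {A B : FinStr.{u, v, w} L}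
    (h : A.pairing = B.pairing) : Nonempty (A.carrier ↪[L] B.carrier) := by
  let e := (Finite.equivFin A.carrier).symm
  obtain ⟨b, hb⟩ := FinStr.exists_realize_of_pairing_eq h e
  refine ⟨⟨⟨fun x => b (e.symm x), fun x y hxy => ?_⟩, fun {k} f x => ?_, fun {k} r x => ?_⟩⟩
  · have := hb ((Term.var (e.symm x)).equal (Term.var (e.symm y)))
    simpa using this.2 (by simpa using hxy)
  · have := (hb ((Term.func f fun i => Term.var (e.symm (x i))).equal
      (Term.var (e.symm (Structure.funMap f x))))).1 (by simp)
    simpa [Function.comp_def] using this.symm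
  · have := hb (r.formula fun i => Term.var (e.symm (x i)))
    simpa [Function.comp_def] using this.symm

theorem FinStr.nonempty_equiv_of_pairing_eq {A B : FinStr.{u, v, w} L}
    (h : A.pairing = B.pairing) : Nonempty (A.carrier ≃[L] B.carrier) := by
  obtain ⟨f⟩ := FinStr.nonempty_embedding_of_pairing_eq h
  obtain ⟨g⟩ := FinStr.nonempty_embedding_of_pairing_eq h.symm
  have hf := f.injective.bijective_of_nat_card_le (Nat.card_le_card_of_injective g g.injective)
  exact ⟨⟨Equiv.ofBijective f hf, fun F x => f.map_fun F x, fun r x => f.map_rel r x⟩⟩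

/-- The `Γ`-valued Stone pairing. -/
noncomputable def stonePairing (L : FirstOrder.Language.{u, v}) :
    FinIso.{u, v, w} L → Mea (FO L) :=
  Quotient.lift (s := isoSetoid L) FinStr.mea fun _ _ ⟨e⟩ => FinStr.mea_congr e

theorem stonePairing_injective : Function.Injective (stonePairing.{u, v, w} L) := by
  rintro ⟨A⟩ ⟨B⟩ h
  refine Quotient.sound (FinStr.nonempty_equiv_of_pairing_eq (funext fun d => ?_))
  have : A.gammaPairing d = B.gammaPairing d := congrFun (congrArg Subtype.val h) d
  exact congrArg Subtype.val (Gam.exact.inj this)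

end FiniteStructures

end MeasureLogic

theorem theoremt (L : FirstOrder.Language.{u, v}) :
    -- the space of measures is a Boolean space
    (CompactSpace (Mea (FO L)) ∧ T2Space (Mea (FO L)) ∧
      TopologicalSpace.IsTopologicalBasis {U : Set (Mea (FO L)) | IsClopen U}) ∧
    -- its Boolean algebra of clopens is the Lindenbaum-Tarski algebra of the logic
    (∃ e : LTAlg (FO L) ≃o TopologicalSpace.Clopens (Mea (FO L)),
      ∀ φ : PForm (FO L), (e (LTAlg.mk φ) : Set (Mea (FO L))) = {μ | μ.Sat φ}) ∧
    -- it is the space of prime filters (0-types) of that algebra, and the Stone pairing embeds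
    -- the finite structures in it, each being sent to the set of sentences that it satisfies
    ∃ h : Mea (FO L) ≃ₜ StoneSpace (LTAlg (FO L)),
      (∀ (μ : Mea (FO L)) (φ : PForm (FO L)), LTAlg.mk φ ∈ (h μ).1 ↔ μ.Sat φ) ∧
      ∃ S : FinIso.{u, v, w} L → Mea (FO L),
        (∀ (A : FinStr.{u, v, w} L) (d : FO L), S A.cls d = A.gammaPairing d) ∧
        Function.Injective S ∧
        ∀ (A : FinStr.{u, v, w} L) (φ : PForm (FO L)),
          LTAlg.mk φ ∈ (h (S A.cls)).1 ↔ A.Sat φ := by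
  refine ⟨⟨inferInstance, inferInstance, isTopologicalBasis_isClopen⟩,
    exists_orderIso_clopens (FO L), Mea.homeomorph (FO L), Mea.mk_mem_homeomorph,
    stonePairing L, fun A d => rfl, stonePairing_injective, fun A φ => ?_⟩
  exact (Mea.mk_mem_homeomorph _ φ).trans (A.sat_mea_iff φ)
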